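/- Let $n\le 6$ and let $Y=(y_1,\dots,y_k)\in\mathbb R^{n\times k}$ have rank $n$. Consider the program $$\text{maximize } f(U)=\log|\det U|\quad\text{subject to}\quad \|Uy_i\|_\infty\le 1,\ i=1,\dots,k,\qquad U\in\mathbb R^{n\times n},$$ with $f(U)=-\infty$ for singular $U$. A feasible $U$ is a vertex if $UY\in\{-1,+1\}^{n\times k}$; only vertices with $\det U\ne0$ are considered. When $k=n$, the $n^2$ neighbours of a vertex $U$ are the matrices $U'$ such that $U'Y$ differs from $UY$ exactly in the sign of one entry. Say that a nonsingular vertex $U$ passes the test if * $n\in\{1,3\}$ (no condition); or * $n\in\{2,4,5\}$ and $f(U')<f(U)$ for all $n^2$ neighbours $U'$; or * $n=6$ and some neighbour $U'$ whose objective value is closest to $f(U)$ among all 36 neighbours satisfies $f(U')=f(U)+\log\frac45$. The test depends only on $f(U)$ and on the values of $f$ at the $n^2$ neighbours. 1. If $k=n$, a nonsingular vertex $U$ is a global optimum if and only if it passes the test. 2. Let $k\ge n$ be arbitrary and let $Y_g$ be the matrix formed by $n$ linearly independent columns of $Y$. Define the $n^2$ neighbours of $U$ with respect to $Y_g$ (they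 need not be feasible for $Y$). If a nonsingular vertex $U$ passes the test with respect to $Y_g$, then $U$ is a global optimum of the program for $Y$. If moreover $Y=AX$ with $A$ invertible and $X\in\{-1,+1\}^{n\times k}$ having the maximal subset property (some $n$ columns of $X$ form a matrix whose determinant has the largest absolute value among all matrices in $[-1,1]^{n\times n}$), then a nonsingular vertex $U$ is a global optimum if and only if it passes the test with respect to some such $Y_g$. 3. If $k=n\le5$, every nonsingular vertex that is a local optimum of the program is a global optimum; and every nonsingular vertex all of whose $n^2$ neighbours have strictly smaller objective value is a global optimum. 4. Let $n=6$. * $\{|\det X|: X\in\{-1,+1\}^{6\times6}\}=\{0,32,64,96,128,160\}$. * If $X\in\{-1,+1\}^{6\times 6}$ has maximal $|\det X|$, then the absolute values of the determinants of the 36 matrices obtained from $X$ by changing the sign of one entry form exactly the set $\{128,96,64\}$. * Let $k=6$ and let $U$ be a nonsingular vertex. If $U$ is a global optimum, then the set of ratios $|\det U'/\det U|$ over its 36 neighbours $U'$ is $\{\frac45,\frac35,\frac25\}$. Moreover, $U$ is a global optimum if and only if $|\det U'/\det U|=\frac45$ for some neighbour $U'$; and for each neighbour $U'$ whose objective value is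 closest to $f(U)$, $U$ is a global optimum if and only if $|\det U'/\det U|=\frac45$. -/

import Mathlib

open Matrix

noncomputable section

namespace ParallelepipedFit

variable {n k : ℕ}

/-- Every entry of the matrix is `1` or `-1`. -/
def IsSignMatrix (X : Matrix (Fin n) (Fin k) ℝ) : Prop :=
  ∀ i j, X i j = 1 ∨ X i j = -1

/-- A square `±1` matrix whose determinant has the largest absolute value among all
`±1` matrices of the same size. -/
def IsMaximal (X : Matrix (Fin n) (Fin n) ℝ) : Prop :=
  IsSignMatrix X ∧ ∀ W : Matrix (Fin n) (Fin n) ℝ, IsSignMatrix W → |W.det| ≤ |X.det|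

/-- The maximal subset property: some `n` columns of `X` form a square matrix whose determinant
has the largest absolute value among all `n × n` matrices with entries in `[-1, 1]`. -/
def HasMSP (X : Matrix (Fin n) (Fin k) ℝ) : Prop :=
  ∃ g : Fin n ↪ Fin k, ∀ W : Matrix (Fin n) (Fin n) ℝ,
    (∀ i j, W i j ∈ Set.Icc (-1 : ℝ) 1) → |W.det| ≤ |(X.submatrix id g).det|

/-- The objective `log |det U|`, with the value `-∞` at singular matrices. -/
def objective (U : Matrix (Fin n) (Fin n) ℝ) : EReal :=
  if U.det = 0 then ⊥ else ((Real.log |U.det| : ℝ) : EReal)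

/-- The constraints `‖U yⱼ‖_∞ ≤ 1`, where `yⱼ` runs over the columns of `Y`
(the norm of `Fin n → ℝ` is the sup norm). -/
def IsFeasible (Y : Matrix (Fin n) (Fin k) ℝ) (U : Matrix (Fin n) (Fin n) ℝ) : Prop :=
  ∀ j, ‖U *ᵥ (fun i => Y i j)‖ ≤ 1

/-- `U` is at a vertex of the feasible region: `U Y` is a `±1` matrix. -/
def IsVertex (Y : Matrix (Fin n) (Fin k) ℝ) (U : Matrix (Fin n) (Fin n) ℝ) : Prop :=
  IsSignMatrix (U * Y)

/-- `U` is a global optimum of: maximize `log |det U|` subject to `‖U yⱼ‖_∞ ≤ 1` for all `j`. -/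
def IsGlobalOptimum (Y : Matrix (Fin n) (Fin k) ℝ) (U : Matrix (Fin n) (Fin n) ℝ) : Prop :=
  IsFeasible Y U ∧ ∀ V : Matrix (Fin n) (Fin n) ℝ, IsFeasible Y V → objective V ≤ objective U

/-- `U` is a local optimum of the same program: it is feasible, and no feasible matrix in some
neighbourhood of `U` has a larger objective value. -/
def IsLocalOptimum (Y : Matrix (Fin n) (Fin k) ℝ) (U : Matrix (Fin n) (Fin n) ℝ) : Prop :=
  IsFeasible Y U ∧ IsLocalMaxOn objective {V | IsFeasible Y V} U

/-- The matrix `M` with the sign of its `(i, j)` entry reversed. -/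
def flipEntry (M : Matrix (Fin n) (Fin n) ℝ) (i j : Fin n) : Matrix (Fin n) (Fin n) ℝ :=
  fun a b => if a = i ∧ b = j then -M a b else M a b

/-- For invertible `Y`, the matrix `U'` for which `U' Y` is `U Y` with the sign of the `(i, j)`
entry reversed. When `U Y` is a `±1` matrix, these are the `n²` neighbours of `U`: the matrices
`U' Y` are the `±1` matrices at Hamming distance one from `U Y`. -/
def neighbour (Y U : Matrix (Fin n) (Fin n) ℝ) (i j : Fin n) : Matrix (Fin n) (Fin n) ℝ :=
  flipEntry (U * Y) i j * Y⁻¹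

theorem neighbour_mul (Y U : Matrix (Fin n) (Fin n) ℝ) (hY : Y.det ≠ 0) (i j : Fin n) :
    neighbour Y U i j * Y = flipEntry (U * Y) i j := by
  unfold neighbour
  rw [Matrix.mul_assoc, Matrix.nonsing_inv_mul Y (isUnit_iff_ne_zero.mpr hY), Matrix.mul_one]

/-- The objective values at the `n²` neighbours. -/
def neighbourValues (Y U : Matrix (Fin n) (Fin n) ℝ) : Fin n → Fin n → EReal :=
  fun i j => objective (neighbour Y U i j)

/-- Among the values `w a b`, the value `w i j` is one of those closest to `v`. -/
def IsNearest (v : EReal) (w : Fin n → Fin n → EReal) (i j : Fin n) : Prop :=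
  ∀ a b, (w i j - v).abs ≤ (w a b - v).abs

/-- The stopping test, which sees only the objective value `v` at a nonsingular vertex and the
objective values `w i j` at its `n²` neighbours.
For `n ≤ 5` it asks that all neighbours have a strictly smaller value, except that for `n = 1` and
`n = 3` it accepts every nonsingular vertex; for `n = 6` it asks that some neighbour that is
closest in value has `|det|` equal to `4/5` of that at the vertex. -/
def StoppingTest (v : EReal) (w : Fin n → Fin n → EReal) : Prop :=
  if n = 1 ∨ n = 3 then True
  else if n ≤ 5 then ∀ i j, w i j < v
  else ∃ i j, IsNearest v w i j ∧ w i j = v + ((Real.log (4 / 5) : ℝ) : EReal)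

end ParallelepipedFit

end

/-!
Multiplying by `Y`, a vertex `U` becomes the sign matrix `X = U * Y`, and a neighbour becomes `X`
with one entry reversed; feasible matrices become matrices with entries in `[-1, 1]`, over which
`|det|` is extremal at sign matrices. So `U` is a global optimum if and only if `|det X|` is the
largest value `maxDet n`, and everything reduces to determinants of sign matrices.

*The values.* `|det X|` is a multiple of `2 ^ (n - 1)`, and for `n ≤ 5` the largest value is the
largest multiple that Hadamard's inequality allows. In order `6` three of the rows have pairwise
inner products `±2`, and orthogonalizing them improves Hadamard's bound to
`IsSignMatrix.sq_det_le_of_six`, which excludes `192`.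

*The weights.* The share `weight X i j` of an entry in its cofactor expansion governs all
comparisons: reversing the entry multiplies the determinant by `1 - 2 * weight X i j`
(`det_flipEntry`). The weights of a row are fractions `a j / s` with `|det X| = 2 ^ (n - 2) * s`;
they sum to `1`, their numerators are bounded by the minors of order `n - 1`, and for every other
row the columns of agreement carry half of the weight (`sum_weight_mul_mul`). As `X` is
nonsingular, the weights are the only solution of these balance equations up to a factor
(`eq_sum_mul_weight`). If all neighbours are worse, then `a j ≥ 1`, so `s ≥ n`, which for `n = 4, 5`
leaves only the largest determinant. Conversely, for a maximal matrix the balance equations admit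
only nonzero numerators for `n = 5`, and only the pattern `(3, 2, 2, 1, 1, 1)` with `s = 10` for
`n = 6` (`IsMaximal.exists_weight_mul_ten`); hence the ratios `4 / 5`, `3 / 5`, `2 / 5`. A ratio
`4 / 5` forces `|det X| = 160` because determinants are multiples of `32`.

*Local optima, `n = 4, 5`.* Local optimality gives nonnegative weights and a sign condition for
pairs of entries of weight zero (`IsSecondOrderMaximal`). Then the supports of the weights of any
two rows meet and no weight exceeds `1 / 2`. A smaller determinant would mean `s = 2`, where all
weights are `0` or `1 / 2`, or `n = 5` and `s = 4`; both are excluded by counting common columns,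
except when all weights are `0` or `1 / 4`, where the sign conditions make two columns
proportional.
-/

noncomputable section

namespace ParallelepipedFit

variable {n k : ℕ}

/-! ### Determinants of sign matrices -/

/-- Hadamard's inequality. -/
theorem sq_det_le_prod_sum_sq (M : Matrix (Fin n) (Fin n) ℝ) :
    M.det ^ 2 ≤ ∏ i, ∑ j, M i j ^ 2 := by
  let b := EuclideanSpace.basisFun (Fin n) ℝ
  have : Fact (Module.finrank ℝ (EuclideanSpace ℝ (Fin n)) = n) := ⟨by simp⟩
  let o := b.toBasis.orientation
  let v : Fin n → EuclideanSpace ℝ (Fin n) := fun i => WithLp.toLp 2 (M i)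
  have h := o.abs_volumeForm_apply_le v
  rw [o.volumeForm_robust' b] at h
  have hd : b.toBasis.det v = M.det := by
    rw [Module.Basis.det_apply, ← Matrix.det_transpose]
    congr 1
  rw [hd] at h
  rw [← sq_abs]
  refine (pow_le_pow_left₀ (abs_nonneg _) h 2).trans_eq ?_
  rw [← Finset.prod_pow]
  refine Finset.prod_congr rfl fun i _ => ?_
  rw [EuclideanSpace.norm_sq_eq]
  simp [v]

namespace IsSignMatrix

theorem mul_self {X : Matrix (Fin n) (Fin k) ℝ} (hX : IsSignMatrix X) (i j) :
    X i j * X i j = 1 := by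
  rcases hX i j with h | h <;> rw [h] <;> norm_num

theorem mem_Icc {X : Matrix (Fin n) (Fin k) ℝ} (hX : IsSignMatrix X) (i j) :
    X i j ∈ Set.Icc (-1 : ℝ) 1 := by
  rcases hX i j with h | h <;> rw [h] <;> norm_num

theorem transpose {X : Matrix (Fin n) (Fin k) ℝ} (hX : IsSignMatrix X) : IsSignMatrix Xᵀ :=
  fun i j => hX j i

theorem submatrix {m l : ℕ} {X : Matrix (Fin n) (Fin k) ℝ} (hX : IsSignMatrix X)
    (f : Fin m → Fin n) (g : Fin l → Fin k) : IsSignMatrix (X.submatrix f g) :=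
  fun i j => hX (f i) (g j)

theorem flipEntry {X : Matrix (Fin n) (Fin n) ℝ} (hX : IsSignMatrix X) (i j : Fin n) :
    IsSignMatrix (flipEntry X i j) := by
  intro a b
  unfold ParallelepipedFit.flipEntry
  split_ifs
  · rcases hX a b with h | h <;> rw [h] <;> norm_num
  · exact hX a b

/-- Subtracting the first row from the others leaves entries in `{0, 2, -2}` there. -/
theorem exists_det_eq_two_pow_mul {X : Matrix (Fin (n + 1)) (Fin (n + 1)) ℝ}
    (hX : IsSignMatrix X) : ∃ z : ℤ, X.det = 2 ^ n * z := by
  have hz : ∀ i j, ∃ z : ℤ, X (Fin.succ i) j - X 0 j = 2 * z := by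
    intro i j
    rcases hX i.succ j with h | h <;> rcases hX 0 j with h' | h' <;> rw [h, h']
    · exact ⟨0, by norm_num⟩
    · exact ⟨1, by norm_num⟩
    · exact ⟨-1, by norm_num⟩
    · exact ⟨0, by norm_num⟩
  choose z hz using hz
  have h0 : ∀ j, ∃ y : ℤ, X 0 j = y := by
    intro j
    rcases hX 0 j with h | h
    · exact ⟨1, by simp [h]⟩
    · exact ⟨-1, by simp [h]⟩
  choose y hy using h0
  let Z : Matrix (Fin (n + 1)) (Fin (n + 1)) ℤ := of (Fin.cons y z)
  let v : Fin (n + 1) → ℝ := Fin.cons 1 fun _ => 2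
  refine ⟨Z.det, ?_⟩
  have h1 : X.det = (of fun i j => v i * (Z.map (Int.castRingHom ℝ)) i j).det := by
    refine det_eq_of_forall_row_eq_smul_add_const (Fin.cons 0 fun _ => 1) 0 (by simp) ?_
    intro i j
    refine Fin.cases ?_ (fun i => ?_) i
    · simp [v, Z, hy]
    · simp only [v, Z, of_apply, Fin.cons_succ, Fin.cons_zero, map_apply, Int.coe_castRingHom]
      rw [← hz i j, ← hy j]
      ring
  rw [h1, det_mul_column, ← RingHom.mapMatrix_apply, ← RingHom.map_det]
  simp [v, Fin.prod_univ_succ]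

end IsSignMatrix

/-- A determinant is affine in each row, so over the cube `[-1, 1]` it is extremal at a vertex. -/
theorem exists_isSignMatrix_abs_det_le (W : Matrix (Fin n) (Fin n) ℝ)
    (hW : ∀ i j, W i j ∈ Set.Icc (-1 : ℝ) 1) :
    ∃ X : Matrix (Fin n) (Fin n) ℝ, IsSignMatrix X ∧ |W.det| ≤ |X.det| := by
  suffices H : ∀ s : Finset (Fin n), ∃ X : Matrix (Fin n) (Fin n) ℝ,
      (∀ i ∈ s, ∀ j, X i j = 1 ∨ X i j = -1) ∧ (∀ i ∉ s, ∀ j, X i j ∈ Set.Icc (-1 : ℝ) 1) ∧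
      |W.det| ≤ |X.det| by
    obtain ⟨X, h1, -, h3⟩ := H Finset.univ
    exact ⟨X, fun i j => h1 i (Finset.mem_univ i) j, h3⟩
  intro s
  induction s using Finset.induction_on with
  | empty => exact ⟨W, by simp, fun i _ => hW i, le_rfl⟩
  | insert i s his ih =>
    obtain ⟨X, h1, h2, h3⟩ := ih
    -- the row of signs of the cofactors maximizes the determinant among the choices of row `i`
    let r : Fin n → ℝ := fun j => if 0 ≤ X.adjugate j i then 1 else -1
    have hr : ∀ j, r j = 1 ∨ r j = -1 := fun j => by
      by_cases h : 0 ≤ X.adjugate j i <;> simp [r, h]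
    have hrow : ∀ q : Fin n → ℝ, (X.updateRow i q).det = ∑ j, q j * X.adjugate j i := by
      intro q
      rw [det_eq_sum_mul_adjugate_row _ i]
      refine Finset.sum_congr rfl fun j _ => ?_
      rw [updateRow_self, adjugate_apply, adjugate_apply]
      simp
    refine ⟨X.updateRow i r, ?_, ?_, h3.trans ?_⟩
    · intro a ha j
      by_cases hai : a = i
      · subst hai; simpa using hr j
      · simpa [updateRow_ne hai] using h1 a (Finset.mem_of_mem_insert_of_ne ha hai) j
    · intro a ha j
      have hai : a ≠ i := fun h => ha (h ▸ Finset.mem_insert_self _ _)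
      rw [updateRow_ne hai]
      exact h2 a (fun h => ha (Finset.mem_insert_of_mem h)) j
    · have hX : X.det = ∑ j, X i j * X.adjugate j i := by
        rw [← hrow (X i), updateRow_eq_self]
      have hR : (X.updateRow i r).det = ∑ j, |X.adjugate j i| := by
        rw [hrow]
        refine Finset.sum_congr rfl fun j _ => ?_
        by_cases h : 0 ≤ X.adjugate j i
        · simp [r, h, abs_of_nonneg h]
        · simp [r, h, abs_of_neg (not_le.mp h)]
      rw [hX, hR]
      refine (Finset.abs_sum_le_sum_abs _ _).trans (le_trans ?_ (le_abs_self _))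
      refine Finset.sum_le_sum fun j _ => ?_
      rw [abs_mul]
      exact mul_le_of_le_one_left (abs_nonneg _) (abs_le.mpr (h2 i his j))

/-! ### Weights -/

/-- The share of the entry `(i, j)` in the cofactor expansion of the determinant along row `i`:
the entry times its cofactor, divided by the determinant. -/
def weight (X : Matrix (Fin n) (Fin n) ℝ) (i j : Fin n) : ℝ := X i j * X⁻¹ j i

theorem weight_transpose (X : Matrix (Fin n) (Fin n) ℝ) (i j : Fin n) :
    weight Xᵀ i j = weight X j i := by
  rw [weight, weight, ← transpose_nonsing_inv]; rfl

theorem sum_weight_row {X : Matrix (Fin n) (Fin n) ℝ} (hX : X.det ≠ 0) (i : Fin n) :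
    ∑ j, weight X i j = 1 := by
  have h := congrFun₂ (mul_nonsing_inv X (isUnit_iff_ne_zero.mpr hX)) i i
  rwa [mul_apply, one_apply_eq] at h

theorem sum_weight_col {X : Matrix (Fin n) (Fin n) ℝ} (hX : X.det ≠ 0) (j : Fin n) :
    ∑ i, weight X i j = 1 := by
  simpa only [weight_transpose] using sum_weight_row (X := Xᵀ) (by rwa [det_transpose]) j

/-- The weights of a row balance the agreements of that row with any other row against the
disagreements. -/
theorem sum_weight_mul_mul {X : Matrix (Fin n) (Fin n) ℝ} (hs : IsSignMatrix X) (hX : X.det ≠ 0)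
    {i k : Fin n} (hik : k ≠ i) : ∑ j, weight X i j * (X i j * X k j) = 0 := by
  have h := congrFun₂ (mul_nonsing_inv X (isUnit_iff_ne_zero.mpr hX)) k i
  rw [mul_apply, one_apply_ne hik] at h
  rw [← h]
  refine Finset.sum_congr rfl fun j _ => ?_
  rw [weight]
  linear_combination X⁻¹ j i * X k j * hs.mul_self i j

/-- The entries `(i, j)` and `(k, l)` shrink by the factors `1 - s` and `1 - t` (if the positions
coincide, by the factor `1 - s - t`). The modification of `X` has rank at most two, so its effect
on the determinant is a determinant of order two. -/
theorem det_sub_single_sub_single {X : Matrix (Fin n) (Fin n) ℝ} (hX : X.det ≠ 0)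
    (i j k l : Fin n) (s t : ℝ) :
    (X - Matrix.single i j (s * X i j) - Matrix.single k l (t * X k l)).det =
      X.det * ((1 - s * weight X i j) * (1 - t * weight X k l) -
        s * t * (X i j * X⁻¹ l i) * (X k l * X⁻¹ j k)) := by
  obtain ⟨A, hA0, hA1⟩ : ∃ A : Matrix (Fin n) (Fin 2) ℝ,
      (∀ a, A a 0 = -(if i = a then s * X i j else 0)) ∧
      ∀ a, A a 1 = -(if k = a then t * X k l else 0) :=
    ⟨of fun a => ![-(if i = a then s * X i j else 0), -(if k = a then t * X k l else 0)],
      fun _ => rfl, fun _ => rfl⟩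
  obtain ⟨B, hB0, hB1⟩ : ∃ B : Matrix (Fin 2) (Fin n) ℝ,
      (∀ b, B 0 b = if j = b then 1 else 0) ∧ ∀ b, B 1 b = if l = b then 1 else 0 :=
    ⟨![fun b => if j = b then 1 else 0, fun b => if l = b then 1 else 0],
      fun _ => rfl, fun _ => rfl⟩
  have h1 : X - Matrix.single i j (s * X i j) - Matrix.single k l (t * X k l) =
      X * (1 + (X⁻¹ * A) * B) := by
    rw [Matrix.mul_add, Matrix.mul_one, Matrix.mul_assoc,
      mul_nonsing_inv_cancel_left _ _ (isUnit_iff_ne_zero.mpr hX)]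
    ext a b
    simp only [Matrix.sub_apply, Matrix.add_apply, mul_apply, Fin.sum_univ_two, single_apply,
      hA0, hA1, hB0, hB1, ite_and]
    split_ifs <;> ring
  have h2 : ∀ a, (X⁻¹ * A) a 0 = -(s * X i j * X⁻¹ a i) := by
    intro a
    simp [hA0, mul_apply, mul_comm]
  have h3 : ∀ a, (X⁻¹ * A) a 1 = -(t * X k l * X⁻¹ a k) := by
    intro a
    simp [hA1, mul_apply, mul_comm]
  have h4 : ∀ c, (B * (X⁻¹ * A)) 0 c = (X⁻¹ * A) j c := by
    intro c
    rw [mul_apply]; simp [hB0]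
  have h5 : ∀ c, (B * (X⁻¹ * A)) 1 c = (X⁻¹ * A) l c := by
    intro c
    rw [mul_apply]; simp [hB1]
  rw [h1, det_mul, det_one_add_mul_comm, det_fin_two]
  simp only [Matrix.add_apply, h4, h5, h2, h3, weight, one_apply_eq, one_apply_ne,
    ne_eq, zero_ne_one, one_ne_zero, not_false_eq_true]
  ring

theorem det_flipEntry {X : Matrix (Fin n) (Fin n) ℝ} (hX : X.det ≠ 0) (i j : Fin n) :
    (flipEntry X i j).det = X.det * (1 - 2 * weight X i j) := by
  have h := det_sub_single_sub_single hX i j i j 2 0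
  have h' : flipEntry X i j =
      X - Matrix.single i j (2 * X i j) - Matrix.single i j (0 * X i j) := by
    ext a b
    simp only [flipEntry, Matrix.sub_apply, single_apply]
    by_cases h : a = i ∧ b = j
    · obtain ⟨rfl, rfl⟩ := h; simp; ring
    · have : ¬ (i = a ∧ j = b) := fun e => h ⟨e.1.symm, e.2.symm⟩
      simp [h, this]
  rw [h', h]; ring

/-- Up to sign, the determinant times a weight is a minor of order `n + 1`. -/
theorem exists_abs_det_mul_weight_eq {X : Matrix (Fin (n + 2)) (Fin (n + 2)) ℝ}
    (hs : IsSignMatrix X) (hX : X.det ≠ 0) (i j : Fin (n + 2)) :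
    |X.det| * |weight X i j| = |(X.submatrix i.succAbove j.succAbove).det| ∧
      ∃ a : ℤ, |X.det| * weight X i j = 2 ^ n * a := by
  have hw : X.det * weight X i j =
      X i j * ((-1) ^ (i + j : ℕ) * (X.submatrix i.succAbove j.succAbove).det) := by
    rw [weight, inv_def, Matrix.smul_apply, Ring.inverse_eq_inv', smul_eq_mul,
      adjugate_fin_succ_eq_det_submatrix]
    field_simp
  refine ⟨?_, ?_⟩
  · rw [← abs_mul, hw, abs_mul, abs_mul, abs_pow, abs_neg, abs_one, one_pow, one_mul]
    rcases hs i j with h | h <;> simp [h]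
  · obtain ⟨z, hz⟩ := (hs.submatrix i.succAbove j.succAbove).exists_det_eq_two_pow_mul
    rw [hz] at hw
    have hx : ∃ e : ℤ, X i j * (-1) ^ (i + j : ℕ) = e := by
      rcases hs i j with h | h <;> rcases neg_one_pow_eq_or ℝ (i + j : ℕ) with h' | h' <;>
        rw [h, h']
      exacts [⟨1, by simp⟩, ⟨-1, by simp⟩, ⟨-1, by simp⟩, ⟨1, by simp⟩]
    obtain ⟨e, he⟩ := hx
    rcases abs_choice X.det with h | h <;> rw [h]
    · exact ⟨e * z, by push_cast; rw [hw, ← he]; ring⟩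
    · exact ⟨-(e * z), by push_cast; rw [neg_mul, hw, ← he]; ring⟩

/-! ### The largest determinants of sign matrices of order at most six -/

/-- The largest `|det X|` over the `±1` matrices `X` of order `n`, for `n ≤ 6`
(the value for larger `n` is irrelevant). -/
def maxDet : ℕ → ℕ
  | 0 => 1
  | 1 => 1
  | 2 => 2
  | 3 => 4
  | 4 => 16
  | 5 => 48
  | _ => 160

namespace IsSignMatrix

theorem sum_sq {X : Matrix (Fin n) (Fin k) ℝ} (hX : IsSignMatrix X) (i : Fin n) :
    ∑ j, X i j ^ 2 = k := by
  simp [pow_two, hX.mul_self]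

theorem exists_abs_det_eq {X : Matrix (Fin (n + 1)) (Fin (n + 1)) ℝ} (hX : IsSignMatrix X) :
    ∃ N : ℕ, |X.det| = 2 ^ n * N := by
  obtain ⟨z, hz⟩ := hX.exists_det_eq_two_pow_mul
  refine ⟨z.natAbs, ?_⟩
  rw [hz, abs_mul, abs_of_pos (by positivity : (0 : ℝ) < 2 ^ n), Nat.cast_natAbs, Int.cast_abs]

theorem sq_det_le {X : Matrix (Fin n) (Fin n) ℝ} (hX : IsSignMatrix X) :
    X.det ^ 2 ≤ (n : ℝ) ^ n := by
  refine (sq_det_le_prod_sum_sq X).trans_eq ?_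
  simp [hX.sum_sq]

/-- Two rows of even length differ in an even number of places if and only if they contain the
same number of entries `-1` modulo `2`; for rows of length six their inner product is then not
divisible by `4`. -/
theorem exists_parity {X : Matrix (Fin n) (Fin 6) ℝ} (hX : IsSignMatrix X) :
    ∃ p : Fin n → ZMod 2, ∀ i l, p i = p l →
      (∑ j, X i j * X l j) ^ 2 = 4 ∨ (∑ j, X i j * X l j) ^ 2 = 36 := by
  have hm : ∀ i j, ∃ m : ℤ, X i j = 1 - 2 * m ∧ (m = 0 ∨ m = 1) := by
    intro i j
    rcases hX i j with h | h
    · exact ⟨0, by simp [h]⟩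
    · exact ⟨1, by rw [h]; norm_num⟩
  choose m hm hm' using hm
  refine ⟨fun i => ((∑ j, m i j : ℤ) : ZMod 2), fun i l hil => ?_⟩
  have hil' := (ZMod.intCast_eq_intCast_iff_dvd_sub _ _ 2).mp hil
  have hg : ∑ j, X i j * X l j =
      ((6 - 2 * ∑ j, m i j - 2 * ∑ j, m l j + 4 * ∑ j, m i j * m l j : ℤ) : ℝ) := by
    push_cast
    simp only [hm, Fin.sum_univ_six]
    ring
  have hb : |∑ j, X i j * X l j| ≤ 6 := by
    refine (Finset.abs_sum_le_sum_abs _ _).trans ?_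
    refine (Finset.sum_le_sum (g := fun _ => (1 : ℝ)) fun j _ => ?_).trans (by simp)
    rcases hX i j with h | h <;> rcases hX l j with h' | h' <;> rw [h, h'] <;> norm_num
  rw [hg] at hb ⊢
  generalize ∑ j, m i j * m l j = r at *
  obtain ⟨q, hq⟩ := hil'
  generalize ∑ j, m i j = a at *
  generalize ∑ j, m l j = b at *
  have h1 : |6 - 2 * a - 2 * b + 4 * r| ≤ 6 := by exact_mod_cast hb
  rw [abs_le] at h1
  have h2 : 6 - 2 * a - 2 * b + 4 * r = 2 ∨ 6 - 2 * a - 2 * b + 4 * r = -2 ∨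
      6 - 2 * a - 2 * b + 4 * r = 6 ∨ 6 - 2 * a - 2 * b + 4 * r = -6 := by omega
  rcases h2 with h | h | h | h <;> rw [h] <;> norm_num

/-- Orthogonalizing row `k` against row `i`, and approximately orthogonalizing row `l` against
both, in Hadamard's inequality. -/
theorem sq_det_le_of_three_rows {X : Matrix (Fin 6) (Fin 6) ℝ} (hX : IsSignMatrix X)
    {i k l : Fin 6} (hik : i ≠ k) (hil : i ≠ l) (hkl : k ≠ l)
    (h1 : (∑ j, X i j * X k j) ^ 2 = 4) (h2 : (∑ j, X i j * X l j) ^ 2 = 4)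
    (h3 : (∑ j, X k j * X l j) ^ 2 = 4) : X.det ^ 2 ≤ 34560 := by
  obtain ⟨a, ha⟩ : ∃ a, a = ∑ j, X i j * X k j := ⟨_, rfl⟩
  obtain ⟨b, hb⟩ : ∃ b, b = ∑ j, X i j * X l j := ⟨_, rfl⟩
  obtain ⟨c, hc⟩ : ∃ c, c = ∑ j, X k j * X l j := ⟨_, rfl⟩
  rw [← ha] at h1; rw [← hb] at h2; rw [← hc] at h3
  have si := hX.sum_sq i
  have sk := hX.sum_sq k
  have sl := hX.sum_sq l
  let X1 := X.updateRow l (X l + (-(b / 8)) • X i)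
  let X2 := X1.updateRow l (X1 l + (-(c / 8)) • X1 k)
  let X3 := X2.updateRow k (X2 k + (-(a / 6)) • X2 i)
  have hdet : X3.det = X.det := by
    rw [det_updateRow_add_smul_self _ hik.symm, det_updateRow_add_smul_self _ hkl.symm,
      det_updateRow_add_smul_self _ hil.symm]
  have hrk : ∀ j, X3 k j = X k j - a / 6 * X i j := by
    intro j
    simp [X3, X2, X1, hil, hkl]
    ring
  have hrl : ∀ j, X3 l j = X l j - b / 8 * X i j - c / 8 * X k j := by
    intro j
    simp [X3, X2, X1, hkl, hkl.symm]
    ring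
  have hro : ∀ r, r ≠ k → r ≠ l → ∀ j, X3 r j = X r j := by
    intro r hk hl j
    simp [X3, X2, X1, hk, hl]
  have nk : ∑ j, X3 k j ^ 2 = 16 / 3 := by
    have : ∑ j, X3 k j ^ 2 = ∑ j, X k j ^ 2 - a / 3 * ∑ j, X i j * X k j
        + a ^ 2 / 36 * ∑ j, X i j ^ 2 := by
      simp only [hrk, Finset.mul_sum, ← Finset.sum_sub_distrib, ← Finset.sum_add_distrib]
      exact Finset.sum_congr rfl fun j _ => by ring
    rw [this, si, sk, ← ha]
    push_cast
    linear_combination (-1 / 6) * h1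
  have nl : ∑ j, X3 l j ^ 2 ≤ 5 := by
    have : ∑ j, X3 l j ^ 2 = ∑ j, X l j ^ 2 + b ^ 2 / 64 * ∑ j, X i j ^ 2
        + c ^ 2 / 64 * ∑ j, X k j ^ 2 - b / 4 * ∑ j, X i j * X l j
        - c / 4 * ∑ j, X k j * X l j + b * c / 32 * ∑ j, X i j * X k j := by
      simp only [hrl, Finset.mul_sum, ← Finset.sum_sub_distrib, ← Finset.sum_add_distrib]
      exact Finset.sum_congr rfl fun j _ => by ring
    rw [this, si, sk, sl, ← ha, ← hb, ← hc]
    push_cast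
    have : b * c * a ≤ 8 := by
      have : (b * c * a) ^ 2 = 8 ^ 2 := by rw [mul_pow, mul_pow, h1, h2, h3]; norm_num
      rcases sq_eq_sq_iff_eq_or_eq_neg.mp this with h | h <;> rw [h]
      norm_num
    linarith
  rw [← hdet]
  refine (sq_det_le_prod_sum_sq X3).trans ?_
  rw [← Finset.mul_prod_erase _ _ (Finset.mem_univ k),
    ← Finset.mul_prod_erase _ _ (Finset.mem_erase.mpr ⟨hkl.symm, Finset.mem_univ l⟩), nk]
  have hrest : ∏ r ∈ (Finset.univ.erase k).erase l, ∑ j, X3 r j ^ 2 = 6 ^ 4 := by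
    rw [Finset.prod_congr rfl (g := fun _ => (6 : ℝ))]
    · rw [Finset.prod_const, Finset.card_erase_of_mem
        (Finset.mem_erase.mpr ⟨hkl.symm, Finset.mem_univ l⟩),
        Finset.card_erase_of_mem (Finset.mem_univ k)]
      simp
    · intro r hr
      simp only [Finset.mem_erase, Finset.mem_univ, and_true] at hr
      simp only [hro r hr.2 hr.1, hX.sum_sq]
      norm_num
  rw [hrest]
  linarith

theorem det_eq_zero_of_sq_inner_eq {X : Matrix (Fin 6) (Fin 6) ℝ} (hX : IsSignMatrix X)
    {i k : Fin 6} (hik : i ≠ k) (h : (∑ j, X i j * X k j) ^ 2 = 36) : X.det = 0 := by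
  obtain ⟨a, ha⟩ : ∃ a, a = ∑ j, X i j * X k j := ⟨_, rfl⟩
  rw [← ha] at h
  -- equality in the Cauchy-Schwarz inequality: the rows are proportional
  have h0 : ∑ j, (X k j + (-(a / 6)) * X i j) ^ 2 = 0 := by
    have : ∑ j, (X k j + (-(a / 6)) * X i j) ^ 2 = ∑ j, X k j ^ 2
        - a / 3 * ∑ j, X i j * X k j + a ^ 2 / 36 * ∑ j, X i j ^ 2 := by
      simp only [Finset.mul_sum, ← Finset.sum_sub_distrib, ← Finset.sum_add_distrib]
      exact Finset.sum_congr rfl fun j _ => by ring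
    rw [this, hX.sum_sq, hX.sum_sq, ← ha]
    push_cast
    linear_combination (-1 / 6) * h
  rw [← det_updateRow_add_smul_self X hik.symm (-(a / 6))]
  refine det_eq_zero_of_row_eq_zero k fun j => ?_
  rw [Finset.sum_eq_zero_iff_of_nonneg fun j _ => sq_nonneg _] at h0
  simpa using h0 j (Finset.mem_univ j)

theorem sq_det_le_of_six {X : Matrix (Fin 6) (Fin 6) ℝ} (hX : IsSignMatrix X) :
    X.det ^ 2 ≤ 34560 := by
  obtain ⟨p, hp⟩ := hX.exists_parity
  obtain ⟨c, hc⟩ := Fintype.exists_lt_card_fiber_of_mul_lt_card (n := 2) p (by simp)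
  obtain ⟨i, hi, k, hk, l, hl, hik, hil, hkl⟩ := Finset.two_lt_card.mp hc
  simp only [Finset.mem_filter, Finset.mem_univ, true_and] at hi hk hl
  by_cases h0 : X.det = 0
  · rw [h0]; norm_num
  refine hX.sq_det_le_of_three_rows hik hil hkl ?_ ?_ ?_
  · exact (hp i k (hi.trans hk.symm)).resolve_right fun h =>
      h0 (hX.det_eq_zero_of_sq_inner_eq hik h)
  · exact (hp i l (hi.trans hl.symm)).resolve_right fun h =>
      h0 (hX.det_eq_zero_of_sq_inner_eq hil h)
  · exact (hp k l (hk.trans hl.symm)).resolve_right fun h =>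
      h0 (hX.det_eq_zero_of_sq_inner_eq hkl h)

theorem abs_det_le_maxDet (hn : n ≤ 6) {X : Matrix (Fin n) (Fin n) ℝ} (hX : IsSignMatrix X) :
    |X.det| ≤ maxDet n := by
  -- in each order, the next multiple of `2 ^ (n - 1)` violates the bound on the square
  have key : ∀ (m B b : ℕ) {X : Matrix (Fin (m + 1)) (Fin (m + 1)) ℝ}, IsSignMatrix X →
      X.det ^ 2 ≤ B → B < (2 ^ m * (b + 1)) ^ 2 → |X.det| ≤ (2 ^ m * b : ℕ) := by
    intro m B b X hX h1 h2
    obtain ⟨N, hN⟩ := hX.exists_abs_det_eq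
    rw [← sq_abs, hN] at h1
    rw [hN]
    have h3 : (2 ^ m * N) ^ 2 < (2 ^ m * (b + 1)) ^ 2 :=
      lt_of_le_of_lt (by exact_mod_cast h1) h2
    have h4 := lt_of_mul_lt_mul_left (lt_of_pow_lt_pow_left₀ 2 (Nat.zero_le _) h3)
      (Nat.zero_le _)
    exact_mod_cast Nat.mul_le_mul_left _ (Nat.lt_succ_iff.mp h4)
  have h := hX.sq_det_le
  interval_cases n
  · simp [maxDet]
  · exact key 0 1 1 hX (by simpa using h) (by norm_num)
  · exact key 1 4 1 hX (by exact_mod_cast h) (by norm_num)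
  · exact key 2 27 1 hX (by exact_mod_cast h) (by norm_num)
  · exact key 3 256 2 hX (by exact_mod_cast h) (by norm_num)
  · exact key 4 3125 3 hX (by exact_mod_cast h) (by norm_num)
  · exact key 5 34560 5 hX (by exact_mod_cast hX.sq_det_le_of_six) (by norm_num)

end IsSignMatrix

theorem abs_det_le_maxDet_of_mem_Icc (hn : n ≤ 6) {W : Matrix (Fin n) (Fin n) ℝ}
    (hW : ∀ i j, W i j ∈ Set.Icc (-1 : ℝ) 1) : |W.det| ≤ maxDet n := by
  obtain ⟨X, hX, h⟩ := exists_isSignMatrix_abs_det_le W hW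
  exact h.trans (hX.abs_det_le_maxDet hn)

theorem IsSignMatrix.abs_det_eq_maxDet_of_le_three (hn : n ≤ 3) {X : Matrix (Fin n) (Fin n) ℝ}
    (hX : IsSignMatrix X) (h0 : X.det ≠ 0) : |X.det| = maxDet n := by
  refine le_antisymm (hX.abs_det_le_maxDet (by omega)) ?_
  rcases n with - | n
  · simp [maxDet]
  · obtain ⟨N, hN⟩ := hX.exists_abs_det_eq
    have h1 : 1 ≤ N := by
      rcases Nat.eq_zero_or_pos N with rfl | h
      · simp [h0] at hN
      · exact h
    have h2 : (1 : ℝ) ≤ N := by exact_mod_cast h1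
    rw [hN]
    have hn' : n ≤ 2 := by omega
    interval_cases n <;> norm_num [maxDet] <;> linarith

theorem exists_isSignMatrix_abs_det_eq (Z : Matrix (Fin n) (Fin n) ℤ)
    (hZ : ∀ i j, Z i j = 1 ∨ Z i j = -1) {d : ℕ} (hd : Z.det.natAbs = d) :
    ∃ X : Matrix (Fin n) (Fin n) ℝ, IsSignMatrix X ∧ |X.det| = d := by
  refine ⟨Z.map (Int.castRingHom ℝ), fun i j => ?_, ?_⟩
  · rcases hZ i j with h | h <;> simp [h]
  · rw [← RingHom.mapMatrix_apply, ← RingHom.map_det, ← hd]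
    simp [Nat.cast_natAbs]

theorem exists_isSignMatrix_abs_det_eq_maxDet (h4 : 4 ≤ n) (h6 : n ≤ 6) :
    ∃ X : Matrix (Fin n) (Fin n) ℝ, IsSignMatrix X ∧ |X.det| = maxDet n := by
  interval_cases n
  · refine exists_isSignMatrix_abs_det_eq (of fun i j => if i = j then -1 else 1)
      (fun i j => by rw [of_apply]; split_ifs <;> simp) ?_
    simp [maxDet, det_succ_row_zero, Fin.sum_univ_succ, Fin.succAbove]
  · refine exists_isSignMatrix_abs_det_eq (of fun i j => if i = j then -1 else 1)
      (fun i j => by rw [of_apply]; split_ifs <;> simp) ?_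
    simp [maxDet, det_succ_row_zero, Fin.sum_univ_succ, Fin.succAbove]
  · -- the blocks are `J - 2`, `J`, `-J` and `J - 2`, where `J` is the all-ones matrix of order 3
    refine exists_isSignMatrix_abs_det_eq
      (of fun i j => if i = j ∨ (3 ≤ i ∧ j < 3) then -1 else 1)
      (fun i j => by rw [of_apply]; split_ifs <;> simp) ?_
    simp [maxDet, det_succ_row_zero, Fin.sum_univ_succ, Fin.succAbove]

theorem exists_isSignMatrix_abs_det_eq_thirtyTwo :
    ∃ X : Matrix (Fin 6) (Fin 6) ℝ, IsSignMatrix X ∧ |X.det| = (32 : ℕ) := by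
  refine exists_isSignMatrix_abs_det_eq (of fun i j => if j < i then -1 else 1)
    (fun i j => by rw [of_apply]; split_ifs <;> simp) ?_
  simp [det_succ_row_zero, Fin.sum_univ_succ, Fin.succAbove]

/-! ### Weights of a sign matrix: arithmetic -/

/-- The determinant and all weights are commensurable: the weights are fractions with the common
denominator `s`, and their numerators are bounded because minors are. -/
theorem exists_weight_mul_eq_int {X : Matrix (Fin (n + 2)) (Fin (n + 2)) ℝ}
    (hn : n + 1 ≤ 6) (hs : IsSignMatrix X) (hX : X.det ≠ 0) :
    ∃ s : ℕ, 0 < s ∧ 2 ∣ s ∧ |X.det| = 2 ^ n * s ∧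
      ∀ i j, ∃ a : ℤ, weight X i j * s = a ∧ 2 ^ n * a ≤ maxDet (n + 1) := by
  obtain ⟨N, hN⟩ := hs.exists_abs_det_eq
  have hd : |X.det| = 2 ^ n * (2 * N : ℕ) := by rw [hN]; push_cast; ring
  have hpos : 0 < N := by
    rcases Nat.eq_zero_or_pos N with rfl | h
    · simp [hX] at hN
    · exact h
  refine ⟨2 * N, by omega, by omega, hd, fun i j => ?_⟩
  obtain ⟨h1, a, ha⟩ := exists_abs_det_mul_weight_eq hs hX i j
  have h2 : |X.det| * weight X i j ≤ maxDet (n + 1) := by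
    refine le_trans ?_ (h1.trans_le ((hs.submatrix _ _).abs_det_le_maxDet hn))
    exact mul_le_mul_of_nonneg_left (le_abs_self _) (abs_nonneg _)
  refine ⟨a, ?_, ?_⟩
  · rw [hd] at ha
    have h2n : (0 : ℝ) < 2 ^ n := by positivity
    refine mul_left_cancel₀ h2n.ne' ?_
    rw [← ha]; ring
  · rw [ha] at h2
    exact_mod_cast h2

/-- The vectors orthogonal to all rows of a nonsingular matrix but one form a line. -/
theorem eq_sum_mul_weight {X : Matrix (Fin n) (Fin n) ℝ} (hs : IsSignMatrix X) (hX : X.det ≠ 0)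
    (i : Fin n) (b : Fin n → ℝ) (hb : ∀ k, k ≠ i → ∑ j, b j * (X i j * X k j) = 0) (j : Fin n) :
    b j = (∑ l, b l) * weight X i j := by
  have h1 : X *ᵥ (fun j => X i j * b j) = Pi.single i (∑ l, b l) := by
    ext k
    by_cases hk : k = i
    · subst hk
      simp only [mulVec, dotProduct, Pi.single_eq_same]
      refine Finset.sum_congr rfl fun l _ => ?_
      linear_combination b l * hs.mul_self k l
    · rw [Pi.single_eq_of_ne hk, ← hb k hk, mulVec, dotProduct]
      exact Finset.sum_congr rfl fun l _ => by ring
  have h2 := congrArg (fun v => (X⁻¹ *ᵥ v) j) h1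
  simp only [mulVec_mulVec, nonsing_inv_mul X (isUnit_iff_ne_zero.mpr hX), one_mulVec,
    mulVec_single, MulOpposite.smul_eq_mul_unop, Pi.smul_apply, MulOpposite.unop_op,
    col_apply] at h2
  rw [weight]
  linear_combination X i j * h2 - b j * hs.mul_self i j

theorem exists_sum_eq_card_sub {ι : Type*} (s : Finset ι) (v : ι → ℝ)
    (hv : ∀ j, v j = 1 ∨ v j = -1) : ∃ m : ℕ, m ≤ s.card ∧ ∑ j ∈ s, v j = (s.card : ℝ) - 2 * m := by
  classical
  induction s using Finset.induction_on with
  | empty => exact ⟨0, by simp⟩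
  | insert a s ha ih =>
    obtain ⟨m, hm, h⟩ := ih
    rw [Finset.sum_insert ha, Finset.card_insert_of_notMem ha, h]
    rcases hv a with h | h <;> rw [h]
    · exact ⟨m, by omega, by push_cast; ring⟩
    · exact ⟨m + 1, by omega, by push_cast; ring⟩

/-- Let the weights of a row be `a j / s`, and let the value `r` occur `N r` times among the
`a j`. The other rows partition each level set of `a` into agreements and disagreements with the
given row; the numbers of disagreements `m r` balance. If the balance forces a second linear
relation, with coefficients `c r`, then this relation is a multiple of the first. -/
theorem mul_eq_sum_mul_of_balanced {X : Matrix (Fin n) (Fin n) ℝ} (hs : IsSignMatrix X)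
    (hX : X.det ≠ 0) (i : Fin n) {s : ℕ} (a : Fin n → Fin 4)
    (ha : ∀ j, weight X i j * s = (a j : ℕ)) {N : Fin 4 → ℕ}
    (hN : ∀ r, N r = (Finset.univ.filter fun j => a j = r).card) (c : Fin 4 → ℤ)
    (hc : ∀ m : Fin 4 → ℕ, (∀ r, m r ≤ N r) → ∑ r : Fin 4, (r : ℤ) * (N r - 2 * m r) = 0 →
      ∑ r, c r * (N r - 2 * m r) = 0) (j : Fin n) :
    c (a j) * s = (∑ r, c r * N r) * (a j : ℕ) := by
  have hfib : ∀ (f : Fin 4 → ℝ) (v : Fin n → ℝ),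
      ∑ j, f (a j) * v j = ∑ r, f r * ∑ j with a j = r, v j := by
    intro f v
    rw [← Finset.sum_fiberwise Finset.univ a]
    refine Finset.sum_congr rfl fun r _ => ?_
    rw [Finset.mul_sum]
    refine Finset.sum_congr rfl fun j hj => ?_
    rw [(Finset.mem_filter.mp hj).2]
  have hb := eq_sum_mul_weight hs hX i (fun j => (c (a j) : ℝ)) (fun k hk => ?_) j
  · have hsum : ∑ l, (c (a l) : ℝ) = ∑ r, (c r : ℝ) * N r := by
      have := hfib (fun r => (c r : ℝ)) fun _ => 1
      simp only [mul_one] at this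
      rw [this]
      simp [hN]
    rw [hsum] at hb
    have h : (c (a j) : ℝ) * s = (∑ r, (c r : ℝ) * N r) * (a j : ℕ) := by
      rw [← ha j]
      linear_combination (s : ℝ) * hb
    exact_mod_cast h
  · have hv : ∀ j, X i j * X k j = 1 ∨ X i j * X k j = -1 := by
      intro j
      rcases hs i j with h | h <;> rcases hs k j with h' | h' <;> simp [h, h']
    choose m hm hm' using fun r =>
      exists_sum_eq_card_sub (Finset.univ.filter fun j => a j = r) _ hv
    simp only [← hN] at hm hm'
    rw [hfib (fun r => (c r : ℝ))]
    simp only [hm']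
    have h0 : ∑ j, ((a j : ℕ) : ℝ) * (X i j * X k j) = 0 := by
      have := sum_weight_mul_mul hs hX hk
      calc ∑ j, ((a j : ℕ) : ℝ) * (X i j * X k j)
          = s * ∑ j, weight X i j * (X i j * X k j) := by
            rw [Finset.mul_sum]
            exact Finset.sum_congr rfl fun j _ => by rw [← ha j]; ring
        _ = 0 := by rw [this, mul_zero]
    rw [hfib (fun r => ((r : ℕ) : ℝ))] at h0
    simp only [hm'] at h0
    exact_mod_cast hc m hm (by exact_mod_cast h0)

/-- Numerators of the weights of a row, with the number of times each value occurs. -/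
theorem exists_numerators {X : Matrix (Fin n) (Fin n) ℝ} (hX : X.det ≠ 0) {s b : ℕ} (hb : b < 4)
    (h0 : ∀ i j, 0 ≤ weight X i j)
    (ha : ∀ i j, ∃ a : ℤ, weight X i j * s = a ∧ a ≤ b) (i : Fin n) :
    ∃ (a : Fin n → Fin 4) (N : Fin 4 → ℕ), (∀ j, weight X i j * s = (a j : ℕ)) ∧
      (∀ r, N r = (Finset.univ.filter fun j => a j = r).card) ∧ (∀ j, N (a j) ≠ 0) ∧
      N 0 + N 1 + N 2 + N 3 = n ∧ N 1 + 2 * N 2 + 3 * N 3 = s ∧ ∀ r, b < r.val → N r = 0 := by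
  have h1 : ∀ j, ∃ a : Fin 4, weight X i j * s = (a : ℕ) ∧ (a : ℕ) ≤ b := by
    intro j
    obtain ⟨a, h, hab⟩ := ha i j
    have h2 : 0 ≤ a := by
      have : (0 : ℝ) ≤ a := h ▸ mul_nonneg (h0 i j) (Nat.cast_nonneg _)
      exact_mod_cast this
    refine ⟨⟨a.toNat, by omega⟩, ?_, by simp; omega⟩
    rw [h]
    have : ((a.toNat : ℤ) : ℝ) = a := by rw [Int.toNat_of_nonneg h2]
    exact_mod_cast this.symm
  choose a ha hab using h1
  refine ⟨a, fun r => (Finset.univ.filter fun j => a j = r).card, ha, fun r => rfl, ?_, ?_, ?_, ?_⟩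
  · intro j
    exact Finset.card_ne_zero_of_mem (Finset.mem_filter.mpr ⟨Finset.mem_univ j, rfl⟩)
  · have := Finset.card_eq_sum_card_fiberwise (f := a) (s := Finset.univ) (t := Finset.univ)
      (fun _ _ => by simp)
    simp only [Finset.card_univ, Fintype.card_fin, Fin.sum_univ_four] at this
    exact this.symm
  · have h2 : (∑ j, (a j : ℕ) : ℕ) = s := by
      have : ((∑ j, (a j : ℕ) : ℕ) : ℝ) = s := by
        push_cast
        simp only [← ha]
        rw [← Finset.sum_mul, sum_weight_row hX, one_mul]
      exact_mod_cast this
    rw [← Finset.sum_fiberwise Finset.univ a] at h2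
    have h3 : ∀ r : Fin 4, ∑ j with a j = r, (a j : ℕ) =
        (Finset.univ.filter fun j => a j = r).card * r := by
      intro r
      rw [Finset.sum_congr rfl (g := fun _ => (r : ℕ)), Finset.sum_const, smul_eq_mul]
      intro j hj
      rw [(Finset.mem_filter.mp hj).2]
    simp only [h3, Fin.sum_univ_four] at h2
    simp at h2
    dsimp only; omega
  · intro r hr
    rw [Finset.card_eq_zero, Finset.filter_eq_empty_iff]
    intro j _ h
    have := hab j
    rw [h] at this
    omega

/-- If no change of a sign increases `|det|`, then all weights are nonnegative. -/
theorem IsMaximal.weight_nonneg {X : Matrix (Fin n) (Fin n) ℝ} (hX : IsMaximal X)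
    (h0 : X.det ≠ 0) (i j : Fin n) : 0 ≤ weight X i j := by
  have h := hX.2 _ (hX.1.flipEntry i j)
  rw [det_flipEntry h0, abs_mul] at h
  have h1 := (mul_le_iff_le_one_right (abs_pos.mpr h0)).mp h
  linarith [(abs_le.mp h1).2]

theorem abs_det_flipEntry_lt_iff {X : Matrix (Fin n) (Fin n) ℝ} (h0 : X.det ≠ 0) (i j : Fin n) :
    |(flipEntry X i j).det| < |X.det| ↔ 0 < weight X i j ∧ weight X i j < 1 := by
  rw [det_flipEntry h0, abs_mul, mul_lt_iff_lt_one_right (abs_pos.mpr h0), abs_lt]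
  constructor <;> rintro ⟨h1, h2⟩ <;> constructor <;> linarith

theorem isMaximal_iff (hn : n ≤ 6) {X : Matrix (Fin n) (Fin n) ℝ} (hs : IsSignMatrix X)
    (h0 : X.det ≠ 0) : IsMaximal X ↔ |X.det| = maxDet n := by
  refine ⟨fun h => le_antisymm (hs.abs_det_le_maxDet hn) ?_, fun h => ⟨hs, fun W hW => ?_⟩⟩
  · rcases Nat.lt_or_ge n 4 with h4 | h4
    · exact (hs.abs_det_eq_maxDet_of_le_three (by omega) h0).ge
    · obtain ⟨W, hW, hd⟩ := exists_isSignMatrix_abs_det_eq_maxDet h4 hn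
      exact hd ▸ h.2 W hW
  · rw [h]
    exact hW.abs_det_le_maxDet hn

theorem IsMaximal.det_ne_zero {X : Matrix (Fin 6) (Fin 6) ℝ} (h : IsMaximal X) : X.det ≠ 0 := by
  obtain ⟨W, hW, hd⟩ := exists_isSignMatrix_abs_det_eq_maxDet (n := 6) (by norm_num) le_rfl
  have := h.2 W hW
  intro h0
  rw [h0, hd] at this
  norm_num [maxDet] at this

/-- A maximal matrix of order `2`, `4` or `5` strictly beats all its neighbours. In order `5` the
numerators of a row sum to `6` and are at most `2`; the patterns `(2, 2, 2, 0, 0)` and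
`(2, 2, 1, 1, 0)` admit too few balanced partitions. -/
theorem IsMaximal.weight_pos_and_lt_one (hn : n = 2 ∨ n = 4 ∨ n = 5)
    {X : Matrix (Fin n) (Fin n) ℝ} (hX : IsMaximal X) (h0 : X.det ≠ 0) (i j : Fin n) :
    0 < weight X i j ∧ weight X i j < 1 := by
  have hnn := hX.weight_nonneg h0
  have hd := (isMaximal_iff (by omega) hX.1 h0).mp hX
  obtain ⟨p, rfl⟩ : ∃ p, n = p + 2 := ⟨n - 2, by omega⟩
  obtain ⟨s, hs, -, hds, ha⟩ := exists_weight_mul_eq_int (by omega) hX.1 h0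
  rw [hd] at hds
  have hds' : maxDet (p + 2) = 2 ^ p * s := by exact_mod_cast hds
  have hs' : (0 : ℝ) < s := by exact_mod_cast hs
  suffices H : ∃ a : ℕ, weight X i j * s = a ∧ 0 < a ∧ a < s by
    obtain ⟨a, h1, h2, h3⟩ := H
    have h2' : (0 : ℝ) < a := by exact_mod_cast h2
    have h3' : (a : ℝ) < s := by exact_mod_cast h3
    rw [← h1] at h2' h3'
    exact ⟨pos_of_mul_pos_left h2' hs'.le, by nlinarith⟩
  rcases hn with h | h | h
  · obtain rfl : p = 0 := by omega
    simp only [maxDet] at hds' ha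
    obtain ⟨a, N, h1, -, h3, h4, h5, h6⟩ := exists_numerators (b := 1) h0 (by norm_num) hnn
      (fun i j => (ha i j).imp fun a h => ⟨h.1, by omega⟩) i
    have e2 := h6 2 (by decide)
    have e3 := h6 3 (by decide)
    refine ⟨a j, h1 j, ?_⟩
    have h7 := h3 j
    generalize a j = r at *
    fin_cases r <;> simp at h7 ⊢ <;> omega
  · obtain rfl : p = 2 := by omega
    simp only [maxDet] at hds' ha
    obtain ⟨a, N, h1, -, h3, h4, h5, h6⟩ := exists_numerators (b := 1) h0 (by norm_num) hnn
      (fun i j => (ha i j).imp fun a h => ⟨h.1, by omega⟩) i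
    have e2 := h6 2 (by decide)
    have e3 := h6 3 (by decide)
    refine ⟨a j, h1 j, ?_⟩
    have h7 := h3 j
    generalize a j = r at *
    fin_cases r <;> simp at h7 ⊢ <;> omega
  · obtain rfl : p = 3 := by omega
    simp only [maxDet] at hds' ha
    obtain ⟨a, N, h1, h2, h3, h4, h5, h6⟩ := exists_numerators (b := 2) h0 (by norm_num) hnn
      (fun i j => (ha i j).imp fun a h => ⟨h.1, by omega⟩) i
    have e3 := h6 3 (by decide)
    have bal := mul_eq_sum_mul_of_balanced hX.1 h0 i a h1 h2
    -- a zero numerator leaves `(2, 2, 2, 0, 0)` and `(2, 2, 1, 1, 0)`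
    have hN0 : N 0 = 0 := by
      by_contra hne
      obtain ⟨l, hl⟩ : ∃ l, a l = 0 := by
        by_contra! hcon
        exact hne (by rw [h2, Finset.card_eq_zero, Finset.filter_eq_empty_iff]; simpa using hcon)
      obtain ⟨q, hq⟩ : ∃ l, a l = 2 := by
        by_contra! hcon
        have : N 2 = 0 := by
          rw [h2, Finset.card_eq_zero, Finset.filter_eq_empty_iff]; simpa using hcon
        omega
      have h2' : N 2 = 2 ∨ N 2 = 3 := by omega
      rcases h2' with h2' | h2'
      · have := bal ![0, 0, 1, 0] (fun m hm h => by
          have m1 := hm 1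
          have m2 := hm 2
          have m3 := hm 3
          simp [Fin.sum_univ_four] at h ⊢
          omega) q
        simp [Fin.sum_univ_four, hq] at this
        omega
      · have := bal ![1, 0, 0, 0] (fun m hm h => by
          have m1 := hm 1
          have m2 := hm 2
          have m3 := hm 3
          simp [Fin.sum_univ_four] at h ⊢
          omega) l
        simp [Fin.sum_univ_four, hl] at this
        omega
    refine ⟨a j, h1 j, ?_⟩
    have h7 := h3 j
    generalize a j = r at *
    fin_cases r <;> simp at h7 ⊢ <;> omega

/-- In a maximal matrix of order `6` the numerators of a row sum to `10` and are at most `3`;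
each pattern other than `(3, 2, 2, 1, 1, 1)` admits too few balanced partitions. -/
theorem IsMaximal.exists_weight_mul_ten {X : Matrix (Fin 6) (Fin 6) ℝ} (hX : IsMaximal X)
    (i : Fin 6) : ∃ a : Fin 6 → Fin 4, (∀ j, weight X i j * 10 = (a j : ℕ)) ∧
      (∀ j, a j ≠ 0) ∧ (∃ j, a j = 1) ∧ (∃ j, a j = 2) ∧ ∃ j, a j = 3 := by
  have h0 := hX.det_ne_zero
  have hnn := hX.weight_nonneg h0
  have hd := (isMaximal_iff (by omega) hX.1 h0).mp hX
  obtain ⟨s, hs, -, hds, ha⟩ := exists_weight_mul_eq_int (n := 4) (by omega) hX.1 h0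
  rw [hd] at hds
  have hds' : maxDet 6 = 2 ^ 4 * s := by exact_mod_cast hds
  simp only [maxDet] at hds' ha
  obtain rfl : s = 10 := by omega
  obtain ⟨a, N, h1, h2, h3, h4, h5, h6⟩ := exists_numerators (b := 3) h0 (by norm_num) hnn
    (fun i j => (ha i j).imp fun a h => ⟨h.1, by omega⟩) i
  have bal := mul_eq_sum_mul_of_balanced hX.1 h0 i a h1 h2
  have hex : ∀ r, N r ≠ 0 → ∃ j, a j = r := by
    intro r hr
    by_contra! hcon
    exact hr (by rw [h2, Finset.card_eq_zero, Finset.filter_eq_empty_iff]; simpa using hcon)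
  suffices H : N 0 = 0 ∧ N 1 = 3 ∧ N 2 = 2 ∧ N 3 = 1 by
    refine ⟨a, by exact_mod_cast h1, fun j hj => h3 j (hj ▸ H.1), hex 1 (by omega),
      hex 2 (by omega), hex 3 (by omega)⟩
  -- each of the other solutions of the two linear equations is refuted by one further relation
  have hcases : (N 0 = 0 ∧ N 1 = 3 ∧ N 2 = 2 ∧ N 3 = 1) ∨ (2 ≤ N 3) ∨
      (N 3 = 1 ∧ N 2 = 3 ∧ N 1 = 1) ∨ (N 3 = 0 ∧ N 2 = 5 ∧ N 0 = 1) ∨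
      (N 3 = 0 ∧ N 2 = 4 ∧ N 1 = 2) := by omega
  rcases hcases with h | h | h | h | h
  · exact h
  · exfalso
    obtain ⟨q, hq⟩ := hex 3 (by omega)
    have := bal ![0, 0, 0, 1] (fun m hm h => by
      have m1 := hm 1
      have m2 := hm 2
      have m3 := hm 3
      simp [Fin.sum_univ_four] at h ⊢
      omega) q
    simp [Fin.sum_univ_four, hq] at this
    omega
  · exfalso
    obtain ⟨q, hq⟩ := hex 1 (by omega)
    have := bal ![0, 1, 0, 1] (fun m hm h => by
      have m1 := hm 1
      have m2 := hm 2
      have m3 := hm 3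
      simp [Fin.sum_univ_four] at h ⊢
      omega) q
    simp [Fin.sum_univ_four, hq] at this
    omega
  · exfalso
    obtain ⟨q, hq⟩ := hex 0 (by omega)
    have := bal ![1, 0, 0, 0] (fun m hm h => by
      have m1 := hm 1
      have m2 := hm 2
      have m3 := hm 3
      simp [Fin.sum_univ_four] at h ⊢
      omega) q
    simp [Fin.sum_univ_four, hq] at this
  · exfalso
    obtain ⟨q, hq⟩ := hex 1 (by omega)
    have := bal ![0, 1, 0, 0] (fun m hm h => by
      have m1 := hm 1
      have m2 := hm 2
      have m3 := hm 3
      simp [Fin.sum_univ_four] at h ⊢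
      omega) q
    simp [Fin.sum_univ_four, hq] at this
    omega

/-- Positive weights are at least `1 / s`, so the `n` weights of a row force `s ≥ n`. -/
theorem abs_det_eq_maxDet_of_weight_pos (hn : n = 4 ∨ n = 5) {X : Matrix (Fin n) (Fin n) ℝ}
    (hX : IsSignMatrix X) (h0 : X.det ≠ 0) (hw : ∀ i j, 0 < weight X i j) :
    |X.det| = maxDet n := by
  refine le_antisymm (hX.abs_det_le_maxDet (by omega)) ?_
  obtain ⟨p, rfl⟩ : ∃ p, n = p + 2 := ⟨n - 2, by omega⟩
  obtain ⟨s, hs, h2, hds, ha⟩ := exists_weight_mul_eq_int (by omega) hX h0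
  have hs' : (0 : ℝ) < s := by exact_mod_cast hs
  have h1 : ∀ j, 1 ≤ weight X 0 j * s := by
    intro j
    obtain ⟨a, h, -⟩ := ha 0 j
    have : (0 : ℝ) < a := h ▸ mul_pos (hw 0 j) hs'
    rw [h]
    exact_mod_cast this
  have h3 : ((p + 2 : ℕ) : ℝ) ≤ s := by
    calc ((p + 2 : ℕ) : ℝ) = ∑ _j : Fin (p + 2), (1 : ℝ) := by simp
      _ ≤ ∑ j, weight X 0 j * s := Finset.sum_le_sum fun j _ => h1 j
      _ = s := by rw [← Finset.sum_mul, sum_weight_row h0, one_mul]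
  have h3' : p + 2 ≤ s := by exact_mod_cast h3
  rw [hds]
  rcases hn with h | h
  · obtain rfl : p = 2 := by omega
    have : maxDet 4 ≤ 2 ^ 2 * s := by simp only [maxDet]; omega
    exact_mod_cast this
  · obtain rfl : p = 3 := by omega
    have : maxDet 5 ≤ 2 ^ 3 * s := by simp only [maxDet]; omega
    exact_mod_cast this

/-! ### Second-order conditions at a vertex -/

/-- The first- and second-order conditions satisfied by a sign matrix at which `|det|` is locally
maximal over the cube `[-1, 1]`: no weight is negative, and moving two entries of weight zero
simultaneously towards the interior does not increase `|det|`. -/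
structure IsSecondOrderMaximal (X : Matrix (Fin n) (Fin n) ℝ) : Prop where
  sign : IsSignMatrix X
  det_ne_zero : X.det ≠ 0
  nonneg : ∀ i j, 0 ≤ weight X i j
  second : ∀ i j k l, weight X i j = 0 → weight X k l = 0 →
    0 ≤ weight X i l * weight X k j * (X i j * X k j * (X i l * X k l))

namespace IsSecondOrderMaximal

variable {X : Matrix (Fin n) (Fin n) ℝ}

theorem transpose (h : IsSecondOrderMaximal X) : IsSecondOrderMaximal Xᵀ where
  sign := h.sign.transpose
  det_ne_zero := by rw [det_transpose]; exact h.det_ne_zero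
  nonneg i j := by rw [weight_transpose]; exact h.nonneg j i
  second i j k l := by
    simp only [weight_transpose, transpose_apply]
    intro h1 h2
    have := h.second j i l k h1 h2
    linarith

theorem mul_eq_one_or (h : IsSecondOrderMaximal X) (i k j : Fin n) :
    X i j * X k j = 1 ∨ X i j * X k j = -1 := by
  rcases h.sign i j with h1 | h1 <;> rcases h.sign k j with h2 | h2 <;> simp [h1, h2]

/-- Two rows agree in both or in neither of two columns if each of these columns lies in the
support of the weights of exactly one of the rows, and the two columns in different supports. -/
theorem mul_mul_eq_one (h : IsSecondOrderMaximal X) {i j k l : Fin n} (h1 : weight X i j = 0)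
    (h2 : weight X k l = 0) (h3 : weight X i l ≠ 0) (h4 : weight X k j ≠ 0) :
    (X i j * X k j) * (X i l * X k l) = 1 := by
  have h5 := mul_pos ((h.nonneg i l).lt_of_ne' h3) ((h.nonneg k j).lt_of_ne' h4)
  have h6 := nonneg_of_mul_nonneg_right (h.second i j k l h1 h2) h5
  rcases h.mul_eq_one_or i k j with h7 | h7 <;> rcases h.mul_eq_one_or i k l with h8 | h8 <;>
    rw [h7, h8] at h6 ⊢ <;> linarith

/-- If the supports were disjoint, the two rows would agree everywhere or nowhere on the support
of the first, whereas the weights balance agreements and disagreements. -/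
theorem exists_common_support (h : IsSecondOrderMaximal X) {i k : Fin n} (hik : k ≠ i) :
    ∃ j, weight X i j ≠ 0 ∧ weight X k j ≠ 0 := by
  by_contra! hd
  obtain ⟨j, hj⟩ : ∃ j, weight X k j ≠ 0 := by
    by_contra! hz
    have := sum_weight_row h.det_ne_zero k
    simp [hz] at this
  have hij : weight X i j = 0 := by
    by_contra hne
    exact hj (hd j hne)
  have h0 := sum_weight_mul_mul h.sign h.det_ne_zero hik
  have h1 : ∀ l, weight X i l * (X i l * X k l) = weight X i l * (X i j * X k j) := by
    intro l
    by_cases hl : weight X i l = 0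
    · simp [hl]
    · have h2 := h.mul_mul_eq_one hij (hd l hl) hl hj
      congr 1
      rcases h.mul_eq_one_or i k j with h7 | h7 <;> rw [h7] at h2 ⊢ <;> linarith
  simp only [h1] at h0
  rw [← Finset.sum_mul, sum_weight_row h.det_ne_zero, one_mul] at h0
  rcases h.mul_eq_one_or i k j with h7 | h7 <;> rw [h7] at h0 <;> norm_num at h0

/-- Any other row agrees with row `i` on columns of total weight `1 / 2`, and disagrees with it on
columns of total weight `1 / 2`. -/
theorem weight_le_half (h : IsSecondOrderMaximal X) (hn : 2 ≤ n) (i j : Fin n) :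
    weight X i j ≤ 1 / 2 := by
  obtain ⟨k, hk⟩ : ∃ k, k ≠ i := by
    have : Nontrivial (Fin n) := Fin.nontrivial_iff_two_le.mpr hn
    exact exists_ne i
  have h0 := sum_weight_mul_mul h.sign h.det_ne_zero hk
  have h1 := sum_weight_row h.det_ne_zero i
  -- one of these two sums of nonnegative terms contains `2 * weight X i j`
  have hp : ∑ l, weight X i l * (1 + X i l * X k l) = 1 := by
    simp only [mul_add, mul_one, Finset.sum_add_distrib, h0, h1, add_zero]
  have hm : ∑ l, weight X i l * (1 - X i l * X k l) = 1 := by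
    simp only [mul_sub, mul_one, Finset.sum_sub_distrib, h0, h1, sub_zero]
  rcases h.mul_eq_one_or i k j with h2 | h2
  · have := Finset.single_le_sum (f := fun l => weight X i l * (1 + X i l * X k l))
      (fun l _ => mul_nonneg (h.nonneg i l) (by
        rcases h.mul_eq_one_or i k l with h3 | h3 <;> rw [h3] <;> norm_num)) (Finset.mem_univ j)
    rw [hp] at this
    simp only [h2] at this
    linarith
  · have := Finset.single_le_sum (f := fun l => weight X i l * (1 - X i l * X k l))
      (fun l _ => mul_nonneg (h.nonneg i l) (by
        rcases h.mul_eq_one_or i k l with h3 | h3 <;> rw [h3] <;> norm_num)) (Finset.mem_univ j)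
    rw [hm] at this
    simp only [h2] at this
    linarith

theorem eq_of_proportional_columns (h : IsSecondOrderMaximal X) {p q : Fin n} (c : ℝ)
    (hpq : ∀ k, X k p = c * X k q) : p = q := by
  by_contra hne
  refine h.det_ne_zero (exists_mulVec_eq_zero_iff.mp ⟨Pi.single p 1 - c • Pi.single q 1, ?_, ?_⟩)
  · intro h0
    have := congrFun h0 p
    simp [hne] at this
  · ext k
    rw [mulVec_sub, mulVec_smul]
    simp [hpq k]

/-- If a weight equals `1 / 2`, then on the remaining support of its row every other row is
balanced against a single entry, hence constant relative to the given row; the columns of the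
remaining support are proportional, so there is only one. -/
theorem exists_other_half (h : IsSecondOrderMaximal X) {i p : Fin n} (hp : weight X i p = 1 / 2) :
    ∃ q, q ≠ p ∧ weight X i q = 1 / 2 := by
  have h1 := sum_weight_row h.det_ne_zero i
  rw [← Finset.add_sum_erase _ _ (Finset.mem_univ p), hp] at h1
  obtain ⟨q, hq, hq0⟩ := Finset.exists_ne_zero_of_sum_ne_zero
    (show ∑ j ∈ Finset.univ.erase p, weight X i j ≠ 0 by intro h; rw [h] at h1; norm_num at h1)
  have hopp : ∀ k, k ≠ i → ∀ j, j ≠ p → weight X i j ≠ 0 →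
      X i j * X k j = -(X i p * X k p) := by
    intro k hk j hj hj0
    have h0 := sum_weight_mul_mul h.sign h.det_ne_zero hk
    rw [← Finset.add_sum_erase _ _ (Finset.mem_univ p), hp] at h0
    have hs : (X i p * X k p) * (X i p * X k p) = 1 := by
      rcases h.mul_eq_one_or i k p with h2 | h2 <;> rw [h2] <;> norm_num
    have hz : ∑ l ∈ Finset.univ.erase p,
        weight X i l * (1 + (X i p * X k p) * (X i l * X k l)) = 0 := by
      have : ∑ l ∈ Finset.univ.erase p, weight X i l * (1 + (X i p * X k p) * (X i l * X k l)) =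
          ∑ l ∈ Finset.univ.erase p, weight X i l + (X i p * X k p) *
            ∑ l ∈ Finset.univ.erase p, weight X i l * (X i l * X k l) := by
        rw [Finset.mul_sum, ← Finset.sum_add_distrib]
        exact Finset.sum_congr rfl fun l _ => by ring
      rw [this]
      linear_combination h1 + (X i p * X k p) * h0 - 1 / 2 * hs
    rw [Finset.sum_eq_zero_iff_of_nonneg] at hz
    · have h3 := (mul_eq_zero.mp (hz j (Finset.mem_erase.mpr ⟨hj, Finset.mem_univ j⟩))).resolve_left
        hj0
      linear_combination (X i p * X k p) * h3 - (X i j * X k j) * hs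
    · intro l _
      refine mul_nonneg (h.nonneg i l) ?_
      rcases h.mul_eq_one_or i k p with h2 | h2 <;> rcases h.mul_eq_one_or i k l with h3 | h3 <;>
        rw [h2, h3] <;> norm_num
  have hqp := Finset.ne_of_mem_erase hq
  have huniq : ∀ j, j ≠ p → j ≠ q → weight X i j = 0 := by
    intro j hj hjq
    by_contra hj0
    refine hjq (h.eq_of_proportional_columns (X i j * X i q) fun k => ?_)
    by_cases hk : k = i
    · subst hk
      linear_combination -X k j * h.sign.mul_self k q
    · have e1 := hopp k hk j hj hj0
      have e2 := hopp k hk q hqp hq0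
      linear_combination X i j * e1 - X i j * e2 - X k j * h.sign.mul_self i j
  refine ⟨q, hqp, ?_⟩
  rw [Finset.sum_eq_single_of_mem q hq fun j hj hjq => huniq j (Finset.ne_of_mem_erase hj) hjq]
    at h1
  linarith

/-- If all weights were `0` or `1 / 2`, the number of common columns of the supports of a row and
of all rows, which is at least `2 + (n - 1)`, would be `4`. -/
theorem exists_weight_ne_half (h : IsSecondOrderMaximal X) (hn : 4 ≤ n) :
    ∃ i j, weight X i j ≠ 0 ∧ weight X i j ≠ 1 / 2 := by
  by_contra! hw
  have hw' : ∀ i j, weight X i j = 0 ∨ weight X i j = 1 / 2 := fun i j => by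
    by_cases h0 : weight X i j = 0
    · exact Or.inl h0
    · exact Or.inr (hw i j h0)
  let i : Fin n := ⟨0, by omega⟩
  have hsum : ∑ k, ∑ j, weight X i j * weight X k j = 1 := by
    rw [Finset.sum_comm]
    simp only [← Finset.mul_sum, sum_weight_col h.det_ne_zero, mul_one]
    exact sum_weight_row h.det_ne_zero i
  have hi : ∑ j, weight X i j * weight X i j = 1 / 2 := by
    have : ∀ j, weight X i j * weight X i j = 1 / 2 * weight X i j := by
      intro j
      rcases hw' i j with h0 | h0
      · rw [h0]; norm_num
      · rw [h0]
    simp only [this, ← Finset.mul_sum, sum_weight_row h.det_ne_zero, mul_one]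
  have hk : ∀ k ∈ Finset.univ.erase i, (1 / 4 : ℝ) ≤ ∑ j, weight X i j * weight X k j := by
    intro k hk
    obtain ⟨j, h1, h2⟩ := h.exists_common_support (Finset.ne_of_mem_erase hk)
    have h3 := Finset.single_le_sum (f := fun j => weight X i j * weight X k j)
      (fun l _ => mul_nonneg (h.nonneg i l) (h.nonneg k l)) (Finset.mem_univ j)
    simp only [hw i j h1, hw k j h2] at h3
    linarith
  have h4 := Finset.card_nsmul_le_sum _ _ _ hk
  rw [← Finset.add_sum_erase _ _ (Finset.mem_univ i), hi] at hsum
  rw [Finset.card_erase_of_mem (Finset.mem_univ i), Finset.card_univ, Fintype.card_fin,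
    nsmul_eq_mul] at h4
  have h5 : (3 : ℝ) ≤ ((n - 1 : ℕ) : ℝ) := by exact_mod_cast (by omega : 3 ≤ n - 1)
  linarith

/-- If a row has two weights `1 / 2`, in columns `p` and `q`, then every row has at least one of
the weights in these columns, and some row other than the given one has a weight `1 / 2` there;
with all nonzero weights at least `1 / 4` these columns would sum to more than `2`. -/
theorem weight_ne_half (h : IsSecondOrderMaximal X) (hn : 5 ≤ n)
    (hw : ∀ i j, weight X i j ≠ 0 → 1 / 4 ≤ weight X i j) (i p : Fin n) :
    weight X i p ≠ 1 / 2 := by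
  intro hp
  obtain ⟨q, hqp, hq⟩ := h.exists_other_half hp
  obtain ⟨k₀, hk₀, hkp⟩ := h.transpose.exists_other_half (i := p) (p := i)
    (by rw [weight_transpose, hp])
  rw [weight_transpose] at hkp
  have hrow := sum_weight_row h.det_ne_zero i
  rw [← Finset.add_sum_erase _ _ (Finset.mem_univ p), ← Finset.add_sum_erase _ _
    (Finset.mem_erase.mpr ⟨hqp, Finset.mem_univ q⟩), hp, hq] at hrow
  have hz : ∑ j ∈ (Finset.univ.erase p).erase q, weight X i j = 0 := by linarith
  rw [Finset.sum_eq_zero_iff_of_nonneg fun j _ => h.nonneg i j] at hz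
  have hz' : ∀ j, weight X i j ≠ 0 → j = p ∨ j = q := by
    intro j hj
    by_contra! hne
    exact hj (hz j (by simp [hne]))
  have hk : ∀ k ∈ (Finset.univ.erase i).erase k₀, (1 / 4 : ℝ) ≤ weight X k p + weight X k q := by
    intro k hk
    obtain ⟨j, h1, h2⟩ := h.exists_common_support (i := i) (k := k)
      (Finset.ne_of_mem_erase (Finset.mem_of_mem_erase hk))
    have h3 := hw k j h2
    have h4 := h.nonneg k p
    have h5 := h.nonneg k q
    rcases hz' j h1 with rfl | rfl <;> linarith
  have h4 := Finset.card_nsmul_le_sum _ _ _ hk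
  have hk₀' : k₀ ∈ Finset.univ.erase i := Finset.mem_erase.mpr ⟨hk₀, Finset.mem_univ k₀⟩
  have hsum : ∑ k, (weight X k p + weight X k q) = 2 := by
    rw [Finset.sum_add_distrib, sum_weight_col h.det_ne_zero, sum_weight_col h.det_ne_zero]
    norm_num
  rw [← Finset.add_sum_erase _ _ (Finset.mem_univ i), ← Finset.add_sum_erase _ _ hk₀', hp, hq,
    hkp] at hsum
  rw [Finset.card_erase_of_mem hk₀', Finset.card_erase_of_mem (Finset.mem_univ i),
    Finset.card_univ, Fintype.card_fin, nsmul_eq_mul] at h4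
  have h5 : (3 : ℝ) ≤ ((n - 1 - 1 : ℕ) : ℝ) := by exact_mod_cast (by omega : 3 ≤ n - 1 - 1)
  have h6 := h.nonneg k₀ q
  linarith

/-- In order `5` the weights cannot all be `0` or `1 / 4`. The inner product of rows `i` and `k`
would be `X i z * X k z`, with `z` the column of weight zero in row `i`. For three rows the product
of these signs is `1`, because their sum is `3` modulo `4`; this makes two columns proportional. -/
theorem exists_weight_ne_quarter {X : Matrix (Fin 5) (Fin 5) ℝ} (h : IsSecondOrderMaximal X) :
    ∃ i j, weight X i j ≠ 0 ∧ weight X i j ≠ 1 / 4 := by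
  by_contra! hw
  have hzero : ∀ i, ∃ z, weight X i z = 0 := by
    intro i
    by_contra! hne
    have := sum_weight_row h.det_ne_zero i
    simp only [hw i _ (hne _)] at this
    norm_num at this
  have hrow : ∀ i z, weight X i z = 0 → ∀ j, j ≠ z → weight X i j = 1 / 4 := by
    intro i z hz j hj
    refine hw i j fun h0 => ?_
    have h1 := sum_weight_row h.det_ne_zero i
    rw [← Finset.add_sum_erase _ _ (Finset.mem_univ z), ← Finset.add_sum_erase _ _
      (Finset.mem_erase.mpr ⟨hj, Finset.mem_univ j⟩), hz, h0] at h1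
    have h2 : ∑ l ∈ (Finset.univ.erase z).erase j, weight X i l ≤ _ :=
      Finset.sum_le_card_nsmul _ _ (1 / 4) fun l _ => by
        by_cases hl : weight X i l = 0
        · rw [hl]; norm_num
        · rw [hw i l hl]
    rw [Finset.card_erase_of_mem (Finset.mem_erase.mpr ⟨hj, Finset.mem_univ j⟩),
      Finset.card_erase_of_mem (Finset.mem_univ z), Finset.card_univ, Fintype.card_fin] at h2
    norm_num at h1 h2
    linarith
  have hinner : ∀ i z k, weight X i z = 0 → k ≠ i → ∑ j, X i j * X k j = X i z * X k z := by
    intro i z k hz hk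
    have h0 := sum_weight_mul_mul h.sign h.det_ne_zero hk
    rw [← Finset.add_sum_erase _ _ (Finset.mem_univ z), hz, Finset.sum_congr rfl
      (g := fun j => 1 / 4 * (X i j * X k j)) fun j hj => by
        rw [hrow i z hz j (Finset.ne_of_mem_erase hj)], ← Finset.mul_sum] at h0
    rw [← Finset.add_sum_erase _ _ (Finset.mem_univ z)]
    linarith
  -- every column contributes `3` or `-1` to the sum of the three inner products
  have hprod : ∀ i k l, ∀ a b c : ℝ, (a = 1 ∨ a = -1) → (b = 1 ∨ b = -1) → (c = 1 ∨ c = -1) →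
      ∑ j, X i j * X k j = a → ∑ j, X i j * X l j = b → ∑ j, X k j * X l j = c → a * b * c = 1 := by
    intro i k l a b c ha hb hc h1 h2 h3
    have hm : ∀ j, ∃ m : ℤ, X i j * X k j + X i j * X l j + X k j * X l j = 4 * m - 1 := by
      intro j
      rcases h.sign i j with e1 | e1 <;> rcases h.sign k j with e2 | e2 <;>
        rcases h.sign l j with e3 | e3 <;> rw [e1, e2, e3]
      exacts [⟨1, by norm_num⟩, ⟨0, by norm_num⟩, ⟨0, by norm_num⟩, ⟨0, by norm_num⟩,
        ⟨0, by norm_num⟩, ⟨0, by norm_num⟩, ⟨0, by norm_num⟩, ⟨1, by norm_num⟩]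
    choose m hm using hm
    have hs : a + b + c = ((4 * ∑ j, m j - 5 : ℤ) : ℝ) := by
      rw [← h1, ← h2, ← h3, ← Finset.sum_add_distrib, ← Finset.sum_add_distrib]
      simp only [hm]
      push_cast
      rw [Finset.sum_sub_distrib, Finset.mul_sum]
      simp
    generalize ∑ j, m j = M at hs
    rcases ha with rfl | rfl <;> rcases hb with rfl | rfl <;> rcases hc with rfl | rfl <;>
      first
        | (norm_num; done)
        | (exfalso
           first
             | (have hs' : 4 * M - 5 = 1 := by
                  exact_mod_cast (by linarith : ((4 * M - 5 : ℤ) : ℝ) = 1)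
                omega)
             | (have hs' : 4 * M - 5 = -3 := by
                  exact_mod_cast (by linarith : ((4 * M - 5 : ℤ) : ℝ) = -3)
                omega))
  obtain ⟨z, hz⟩ := hzero 0
  obtain ⟨y, hy⟩ := hzero 1
  have hne : y ≠ z := by
    rintro rfl
    have h1 := sum_weight_col h.det_ne_zero y
    rw [← Finset.add_sum_erase _ _ (Finset.mem_univ 0), ← Finset.add_sum_erase _ _
      (Finset.mem_erase.mpr ⟨one_ne_zero, Finset.mem_univ 1⟩), hz, hy] at h1
    have h2 : ∑ l ∈ (Finset.univ.erase 0).erase 1, weight X l y ≤ _ :=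
      Finset.sum_le_card_nsmul _ _ (1 / 4) fun l _ => by
        by_cases hl : weight X l y = 0
        · rw [hl]; norm_num
        · rw [hw l y hl]
    rw [Finset.card_erase_of_mem (Finset.mem_erase.mpr ⟨one_ne_zero, Finset.mem_univ 1⟩),
      Finset.card_erase_of_mem (Finset.mem_univ 0), Finset.card_univ, Fintype.card_fin] at h2
    norm_num at h1 h2
    linarith
  have hzy := h.mul_mul_eq_one hz hy (by rw [hrow 0 z hz y hne]; norm_num)
    (by rw [hrow 1 y hy z hne.symm]; norm_num)
  refine hne (h.eq_of_proportional_columns (X 0 z * X 0 y) fun l => ?_)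
  by_cases hl0 : l = 0
  · subst hl0
    linear_combination -X 0 y * h.sign.mul_self 0 z
  by_cases hl1 : l = 1
  · subst hl1
    linear_combination -X 1 y * hzy + X 0 z * X 1 z * X 0 y * h.sign.mul_self 1 y
  have h10 := hinner 1 y 0 hy (by simp)
  have e := hprod 0 1 l _ _ _ (h.mul_eq_one_or 0 1 y) (h.mul_eq_one_or 0 l z)
    (h.mul_eq_one_or 1 l y) (by rw [mul_comm (X 0 y), ← h10]; simp only [mul_comm])
    (hinner 0 z l hz hl0) (hinner 1 y l hy hl1)
  linear_combination -X l y * e +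
    X 0 z * X 0 y * X l z * X 1 y * X 1 y * h.sign.mul_self l y +
    X 0 z * X 0 y * X l z * h.sign.mul_self 1 y

theorem abs_det_eq_maxDet (hn : n = 4 ∨ n = 5) (h : IsSecondOrderMaximal X) :
    |X.det| = maxDet n := by
  have hle := h.sign.abs_det_le_maxDet (show n ≤ 6 by omega)
  obtain ⟨p, rfl⟩ : ∃ p, n = p + 2 := ⟨n - 2, by omega⟩
  obtain ⟨s, hs, h2, hds, ha⟩ := exists_weight_mul_eq_int (by omega) h.sign h.det_ne_zero
  rw [hds] at hle ⊢
  have hle' : 2 ^ p * s ≤ maxDet (p + 2) := by exact_mod_cast hle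
  have hs' : (0 : ℝ) < s := by exact_mod_cast hs
  have hnum : ∀ i j, weight X i j ≠ 0 →
      ∃ a : ℤ, weight X i j * s = a ∧ 1 ≤ a ∧ (a : ℝ) ≤ s / 2 := by
    intro i j hij
    obtain ⟨a, h1, -⟩ := ha i j
    refine ⟨a, h1, ?_, ?_⟩
    · have : (0 : ℝ) < a := h1 ▸ mul_pos ((h.nonneg i j).lt_of_ne' hij) hs'
      exact_mod_cast this
    · rw [← h1]
      have := h.weight_le_half (by omega) i j
      nlinarith
  -- the common denominator `2` leaves only the weights `0` and `1 / 2`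
  have hs2 : s ≠ 2 := by
    rintro rfl
    obtain ⟨i, j, h0, h1⟩ := h.exists_weight_ne_half (by omega)
    obtain ⟨a, e1, e2, e3⟩ := hnum i j h0
    have e3' : a ≤ 1 := by
      push_cast at e3
      norm_num at e3
      exact_mod_cast e3
    obtain rfl : a = 1 := by omega
    push_cast at e1
    exact h1 (by linarith)
  rcases hn with hn | hn
  · obtain rfl : p = 2 := by omega
    simp only [maxDet] at hle' ⊢
    obtain rfl : s = 4 := by omega
    norm_num
  · obtain rfl : p = 3 := by omega
    simp only [maxDet] at hle' ⊢
    -- the common denominator `4` leaves only the weights `0`, `1 / 4` and `1 / 2`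
    have hs4 : s ≠ 4 := by
      rintro rfl
      obtain ⟨i, j, h0, h1⟩ := h.exists_weight_ne_quarter
      obtain ⟨a, e1, e2, e3⟩ := hnum i j h0
      have e3' : a ≤ 2 := by
        push_cast at e3
        norm_num at e3
        exact_mod_cast e3
      push_cast at e1
      have ha' : a = 1 ∨ a = 2 := by omega
      rcases ha' with rfl | rfl
      · push_cast at e1
        exact h1 (by linarith)
      · refine h.weight_ne_half le_rfl (fun i j hij => ?_) i j (by push_cast at e1; linarith)
        obtain ⟨b, f1, f2, -⟩ := hnum i j hij
        have f2' : (1 : ℝ) ≤ b := by exact_mod_cast f2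
        push_cast at f1
        linarith
    obtain rfl : s = 6 := by omega
    norm_num

end IsSecondOrderMaximal

/-! ### The optimization problem in terms of sign matrices -/

theorem isFeasible_iff {Y : Matrix (Fin n) (Fin k) ℝ} {U : Matrix (Fin n) (Fin n) ℝ} :
    IsFeasible Y U ↔ ∀ i j, (U * Y) i j ∈ Set.Icc (-1 : ℝ) 1 := by
  have h : ∀ j, ‖U *ᵥ (fun i => Y i j)‖ ≤ 1 ↔ ∀ i, (U * Y) i j ∈ Set.Icc (-1 : ℝ) 1 := by
    intro j
    rw [pi_norm_le_iff_of_nonneg zero_le_one]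
    refine forall_congr' fun i => ?_
    rw [Real.norm_eq_abs, abs_le]
    rfl
  unfold IsFeasible
  simp only [h]
  exact forall_comm

theorem objective_of_det_ne_zero {U : Matrix (Fin n) (Fin n) ℝ} (hU : U.det ≠ 0) :
    objective U = ((Real.log |U.det| : ℝ) : EReal) := if_neg hU

theorem objective_le_iff {U V : Matrix (Fin n) (Fin n) ℝ} (hU : U.det ≠ 0) :
    objective V ≤ objective U ↔ |V.det| ≤ |U.det| := by
  rw [objective_of_det_ne_zero hU]
  by_cases hV : V.det = 0
  · simp [objective, hV]
  · rw [objective_of_det_ne_zero hV, EReal.coe_le_coe_iff,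
      Real.log_le_log_iff (abs_pos.mpr hV) (abs_pos.mpr hU)]

theorem objective_lt_iff {U V : Matrix (Fin n) (Fin n) ℝ} (hU : U.det ≠ 0) :
    objective V < objective U ↔ |V.det| < |U.det| := by
  rw [objective_of_det_ne_zero hU]
  by_cases hV : V.det = 0
  · simp [objective, hV, hU]
  · rw [objective_of_det_ne_zero hV, EReal.coe_lt_coe_iff,
      Real.log_lt_log_iff (abs_pos.mpr hV) (abs_pos.mpr hU)]

theorem objective_eq_add_log_iff {U V : Matrix (Fin n) (Fin n) ℝ} (hU : U.det ≠ 0) {c : ℝ}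
    (hc : 0 < c) : objective V = objective U + ((Real.log c : ℝ) : EReal) ↔
      |V.det / U.det| = c := by
  have hU' := abs_pos.mpr hU
  rw [objective_of_det_ne_zero hU, ← EReal.coe_add, ← Real.log_mul hU'.ne' hc.ne', abs_div,
    div_eq_iff hU'.ne', mul_comm c]
  by_cases hV : V.det = 0
  · have : (0 : ℝ) ≠ |U.det| * c := (mul_pos hU' hc).ne
    simp [objective, hV, this]
  · rw [objective_of_det_ne_zero hV, EReal.coe_eq_coe_iff]
    exact ⟨fun h => Real.log_injOn_pos (abs_pos.mpr hV) (mul_pos hU' hc) h, fun h => by rw [h]⟩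

theorem objective_sub_objective_abs {U V : Matrix (Fin n) (Fin n) ℝ} (hU : U.det ≠ 0)
    (hV : V.det ≠ 0) : (objective V - objective U).abs =
      ENNReal.ofReal (abs (Real.log |V.det / U.det|)) := by
  rw [objective_of_det_ne_zero hU, objective_of_det_ne_zero hV, ← EReal.coe_sub, EReal.abs_def,
    abs_div, Real.log_div (abs_pos.mpr hV).ne' (abs_pos.mpr hU).ne']

theorem isGlobalOptimum_of_abs_det_eq_maxDet (hn : n ≤ 6) {Y : Matrix (Fin n) (Fin k) ℝ}
    {U : Matrix (Fin n) (Fin n) ℝ} {g : Fin n → Fin k} (hY : (Y.submatrix id g).det ≠ 0)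
    (hv : IsVertex Y U) (hU : U.det ≠ 0) (h : |(U * Y.submatrix id g).det| = maxDet n) :
    IsGlobalOptimum Y U := by
  refine ⟨isFeasible_iff.mpr hv.mem_Icc, fun V hV => (objective_le_iff hU).mpr ?_⟩
  have h1 : |(V * Y.submatrix id g).det| ≤ maxDet n :=
    abs_det_le_maxDet_of_mem_Icc hn fun i j => isFeasible_iff.mp hV i (g j)
  rw [← h, det_mul, det_mul, abs_mul, abs_mul] at h1
  exact le_of_mul_le_mul_right h1 (abs_pos.mpr hY)

theorem isGlobalOptimum_iff (hn : n ≤ 6) {Y U : Matrix (Fin n) (Fin n) ℝ} (hY : Y.det ≠ 0)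
    (hv : IsVertex Y U) (hU : U.det ≠ 0) :
    IsGlobalOptimum Y U ↔ |(U * Y).det| = maxDet n := by
  have hX : (U * Y).det ≠ 0 := by rw [det_mul]; exact mul_ne_zero hU hY
  refine ⟨fun h => ?_, fun h => isGlobalOptimum_of_abs_det_eq_maxDet hn (g := id) hY hv hU h⟩
  rw [← isMaximal_iff hn hv hX]
  refine ⟨hv, fun W hW => ?_⟩
  have hW' : W * Y⁻¹ * Y = W := by
    rw [Matrix.mul_assoc, nonsing_inv_mul _ (isUnit_iff_ne_zero.mpr hY), Matrix.mul_one]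
  have h1 := (objective_le_iff hU).mp (h.2 (W * Y⁻¹) (isFeasible_iff.mpr (by
    rw [hW']; exact hW.mem_Icc)))
  rw [← hW', det_mul (W * Y⁻¹), det_mul U, abs_mul, abs_mul]
  exact mul_le_mul_of_nonneg_right h1 (abs_nonneg _)

theorem det_neighbour_div {Y U : Matrix (Fin n) (Fin n) ℝ} (hY : Y.det ≠ 0) (hU : U.det ≠ 0)
    (i j : Fin n) : (neighbour Y U i j).det / U.det = 1 - 2 * weight (U * Y) i j := by
  have hX : (U * Y).det ≠ 0 := by rw [det_mul]; exact mul_ne_zero hU hY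
  have h := det_flipEntry hX i j
  rw [← neighbour_mul Y U hY, det_mul, det_mul] at h
  rw [div_eq_iff hU]
  exact mul_right_cancel₀ hY (by linear_combination h)

theorem objective_neighbour_lt_iff {Y U : Matrix (Fin n) (Fin n) ℝ} (hY : Y.det ≠ 0)
    (hU : U.det ≠ 0) (i j : Fin n) : objective (neighbour Y U i j) < objective U ↔
      0 < weight (U * Y) i j ∧ weight (U * Y) i j < 1 := by
  have hX : (U * Y).det ≠ 0 := by rw [det_mul]; exact mul_ne_zero hU hY
  rw [← abs_det_flipEntry_lt_iff hX, objective_lt_iff hU, ← neighbour_mul Y U hY, det_mul,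
    det_mul, abs_mul, abs_mul, mul_lt_mul_iff_left₀ (abs_pos.mpr hY)]

/-- Local optimality along the paths on which one or two entries of `U * Y` move towards the
interior of `[-1, 1]`. -/
theorem IsLocalOptimum.isSecondOrderMaximal {Y U : Matrix (Fin n) (Fin n) ℝ} (hY : Y.det ≠ 0)
    (hv : IsVertex Y U) (hU : U.det ≠ 0) (h : IsLocalOptimum Y U) :
    IsSecondOrderMaximal (U * Y) := by
  have hX : (U * Y).det ≠ 0 := by rw [det_mul]; exact mul_ne_zero hU hY
  have hs : IsSignMatrix (U * Y) := hv
  obtain ⟨X, hXdef⟩ : ∃ X, X = U * Y := ⟨_, rfl⟩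
  rw [← hXdef] at hX hs ⊢
  have key : ∀ i j k l, ∃ t : ℝ, 0 < t ∧
      |(1 - t * weight X i j) * (1 - t * weight X k l) -
        t * t * (X i j * X⁻¹ l i) * (X k l * X⁻¹ j k)| ≤ 1 := by
    intro i j k l
    let W : ℝ → Matrix (Fin n) (Fin n) ℝ := fun t =>
      X - Matrix.single i j (t * X i j) - Matrix.single k l (t * X k l)
    have hWY : ∀ t, W t * Y⁻¹ * Y = W t := fun t => by
      rw [Matrix.mul_assoc, nonsing_inv_mul _ (isUnit_iff_ne_zero.mpr hY), Matrix.mul_one]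
    have hcont : Continuous fun t => W t * Y⁻¹ := by
      refine Continuous.matrix_mul ?_ continuous_const
      refine continuous_matrix fun a b => ?_
      simp only [W, Matrix.sub_apply, single_apply]
      refine (continuous_const.sub ?_).sub ?_
      · split_ifs <;> fun_prop
      · split_ifs <;> fun_prop
    have hW0 : W 0 * Y⁻¹ = U := by
      simp only [W, zero_mul, single_zero, sub_zero, hXdef]
      rw [Matrix.mul_assoc, mul_nonsing_inv _ (isUnit_iff_ne_zero.mpr hY), Matrix.mul_one]
    have hfeas : ∀ t ∈ Set.Ioo (0 : ℝ) 1, IsFeasible Y (W t * Y⁻¹) := by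
      intro t ht
      rw [isFeasible_iff, hWY]
      intro a b
      have e1 : W t a b = X a b * (1 - (if i = a ∧ j = b then t else 0) -
          (if k = a ∧ l = b then t else 0)) := by
        simp only [W, Matrix.sub_apply, single_apply]
        by_cases c1 : i = a ∧ j = b <;> by_cases c2 : k = a ∧ l = b
        · rw [if_pos c1, if_pos c2, if_pos c1, if_pos c2, c1.1, c1.2, c2.1, c2.2]; ring
        · rw [if_pos c1, if_neg c2, if_pos c1, if_neg c2, c1.1, c1.2]; ring
        · rw [if_neg c1, if_pos c2, if_neg c1, if_pos c2, c2.1, c2.2]; ring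
        · rw [if_neg c1, if_neg c2, if_neg c1, if_neg c2]; ring
      rw [e1]
      obtain ⟨h0, h1⟩ := ht
      rcases hs a b with hx | hx <;> rw [hx] <;> split_ifs <;> constructor <;> linarith
    have htend : Filter.Tendsto (fun t => W t * Y⁻¹) (nhdsWithin 0 (Set.Ioi 0))
        (nhdsWithin U {V | IsFeasible Y V}) := by
      refine tendsto_nhdsWithin_iff.mpr ⟨?_, ?_⟩
      · have := hcont.tendsto 0
        rw [hW0] at this
        exact this.mono_left nhdsWithin_le_nhds
      · filter_upwards [Ioo_mem_nhdsGT (zero_lt_one' ℝ)] with t ht using hfeas t ht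
    obtain ⟨t, h1, h2⟩ := ((htend.eventually h.2).and self_mem_nhdsWithin).exists
    refine ⟨t, h2, ?_⟩
    have h3 := mul_le_mul_of_nonneg_right ((objective_le_iff hU).mp h1) (abs_nonneg Y.det)
    rw [← abs_mul, ← abs_mul, ← det_mul, ← det_mul, hWY, ← hXdef] at h3
    rw [det_sub_single_sub_single hX, abs_mul] at h3
    exact (mul_le_iff_le_one_right (abs_pos.mpr hX)).mp h3
  refine ⟨hs, hX, fun i j => ?_, fun i j k l h1 h2 => ?_⟩
  · -- for equal positions the factor is `1 - 2 * t * weight X i j`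
    obtain ⟨t, ht, h1⟩ := key i j i j
    have h2 := (abs_le.mp h1).2
    have h3 : 0 ≤ t * weight X i j := by
      rw [weight] at h2 ⊢
      linarith
    exact nonneg_of_mul_nonneg_right h3 ht
  · obtain ⟨t, ht, h3⟩ := key i j k l
    have h4 := (abs_le.mp h3).2
    rw [h1, h2] at h4
    have h5 : 0 ≤ (t * t) * ((X i j * X⁻¹ l i) * (X k l * X⁻¹ j k)) := by linarith
    refine (nonneg_of_mul_nonneg_right h5 (mul_pos ht ht)).trans_eq ?_
    rw [weight, weight]
    linear_combination (-X i j * X⁻¹ l i * X k l * X⁻¹ j k) *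
      (hs.mul_self i l + X i l * X i l * hs.mul_self k j)

theorem abs_det_eq_maxDet_of_neighbour_lt (hn : n ≤ 5) {Y U : Matrix (Fin n) (Fin n) ℝ}
    (hY : Y.det ≠ 0) (hv : IsVertex Y U) (hU : U.det ≠ 0)
    (h : ∀ i j, objective (neighbour Y U i j) < objective U) : |(U * Y).det| = maxDet n := by
  have hX : (U * Y).det ≠ 0 := by rw [det_mul]; exact mul_ne_zero hU hY
  rcases Nat.lt_or_ge n 4 with h4 | h4
  · exact IsSignMatrix.abs_det_eq_maxDet_of_le_three (by omega) hv hX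
  · exact abs_det_eq_maxDet_of_weight_pos (by omega) hv hX fun i j =>
      ((objective_neighbour_lt_iff hY hU i j).mp (h i j)).1

theorem IsLocalOptimum.abs_det_eq_maxDet (hn : n ≤ 5) {Y U : Matrix (Fin n) (Fin n) ℝ}
    (hY : Y.det ≠ 0) (hv : IsVertex Y U) (hU : U.det ≠ 0) (h : IsLocalOptimum Y U) :
    |(U * Y).det| = maxDet n := by
  have hX : (U * Y).det ≠ 0 := by rw [det_mul]; exact mul_ne_zero hU hY
  rcases Nat.lt_or_ge n 4 with h4 | h4
  · exact IsSignMatrix.abs_det_eq_maxDet_of_le_three (by omega) hv hX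
  · exact (h.isSecondOrderMaximal hY hv hU).abs_det_eq_maxDet (by omega)

/-! ### Order six -/

/-- Both determinants are multiples of `32` and at most `160`. -/
theorem abs_det_eq_maxDet_of_ratio {Y U : Matrix (Fin 6) (Fin 6) ℝ} (hY : Y.det ≠ 0)
    (hv : IsVertex Y U) (hU : U.det ≠ 0) {i j : Fin 6}
    (h : |(neighbour Y U i j).det / U.det| = 4 / 5) : |(U * Y).det| = maxDet 6 := by
  have hX : (U * Y).det ≠ 0 := by rw [det_mul]; exact mul_ne_zero hU hY
  have hs : IsSignMatrix (U * Y) := hv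
  obtain ⟨M, hM⟩ := hs.exists_abs_det_eq
  obtain ⟨N, hN⟩ := (hs.flipEntry i j).exists_abs_det_eq
  have hle := hs.abs_det_le_maxDet le_rfl
  rw [det_neighbour_div hY hU] at h
  rw [det_flipEntry hX, abs_mul, h, hM] at hN
  rw [hM] at hle
  have h1 : 4 * M = 5 * N := by
    have : (4 * M : ℝ) = 5 * N := by linarith
    exact_mod_cast this
  have h2 : M ≤ 5 := by
    simp only [maxDet] at hle
    push_cast at hle
    have : (M : ℝ) ≤ 5 := by linarith
    exact_mod_cast this
  have h3 : M ≠ 0 := by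
    rintro rfl
    rw [Nat.cast_zero, mul_zero, abs_eq_zero] at hM
    exact hX hM
  obtain rfl : M = 5 := by omega
  rw [hM]
  norm_num [maxDet]

theorem IsMaximal.setOf_abs_one_sub_two_mul_weight {X : Matrix (Fin 6) (Fin 6) ℝ}
    (hX : IsMaximal X) :
    {r : ℝ | ∃ i j, r = |1 - 2 * weight X i j|} = {4 / 5, 3 / 5, 2 / 5} := by
  have hval : ∀ i j (a : ℝ), weight X i j * 10 = a → a ≤ 5 →
      |1 - 2 * weight X i j| = 1 - a / 5 := by
    intro i j a h1 h2
    rw [abs_of_nonneg] <;> linarith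
  ext r
  constructor
  · rintro ⟨i, j, rfl⟩
    obtain ⟨a, ha, ha0, -⟩ := hX.exists_weight_mul_ten i
    have h1 := ha j
    have h2 := ha0 j
    generalize a j = q at *
    simp only [Set.mem_insert_iff, Set.mem_singleton_iff]
    fin_cases q
    · exact absurd rfl h2
    · rw [hval i j _ h1 (by norm_num)]; norm_num
    · rw [hval i j _ h1 (by norm_num)]; norm_num
    · rw [hval i j _ h1 (by norm_num)]; norm_num
  · obtain ⟨a, ha, -, ⟨j1, h1⟩, ⟨j2, h2⟩, ⟨j3, h3⟩⟩ := hX.exists_weight_mul_ten 0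
    rintro (rfl | rfl | rfl)
    · exact ⟨0, j1, by rw [hval 0 j1 _ (ha j1) (by rw [h1]; norm_num), h1]; norm_num⟩
    · exact ⟨0, j2, by rw [hval 0 j2 _ (ha j2) (by rw [h2]; norm_num), h2]; norm_num⟩
    · exact ⟨0, j3, by rw [hval 0 j3 _ (ha j3) (by rw [h3]; norm_num), h3]; norm_num⟩

theorem IsMaximal.setOf_abs_det_flipEntry {X : Matrix (Fin 6) (Fin 6) ℝ} (hX : IsMaximal X) :
    {d : ℝ | ∃ i j, d = |(flipEntry X i j).det|} = {128, 96, 64} := by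
  have h0 := hX.det_ne_zero
  have hd := (isMaximal_iff le_rfl hX.1 h0).mp hX
  have h1 : {d : ℝ | ∃ i j, d = |(flipEntry X i j).det|} =
      (fun r => 160 * r) '' {r : ℝ | ∃ i j, r = |1 - 2 * weight X i j|} := by
    ext d
    simp only [det_flipEntry h0, abs_mul, hd, Set.mem_ofPred_eq, Set.mem_image]
    constructor
    · rintro ⟨i, j, rfl⟩
      exact ⟨_, ⟨i, j, rfl⟩, by norm_num [maxDet]⟩
    · rintro ⟨_, ⟨i, j, rfl⟩, rfl⟩
      exact ⟨i, j, by norm_num [maxDet]⟩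
  rw [h1, hX.setOf_abs_one_sub_two_mul_weight, Set.image_insert_eq, Set.image_insert_eq,
    Set.image_singleton]
  norm_num

theorem setOf_abs_det_isSignMatrix_six :
    {d : ℝ | ∃ X : Matrix (Fin 6) (Fin 6) ℝ, IsSignMatrix X ∧ d = |X.det|} =
      {0, 32, 64, 96, 128, 160} := by
  ext d
  simp only [Set.mem_ofPred_eq, Set.mem_insert_iff, Set.mem_singleton_iff]
  constructor
  · rintro ⟨X, hX, rfl⟩
    obtain ⟨N, hN⟩ := hX.exists_abs_det_eq
    have hle := hX.abs_det_le_maxDet le_rfl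
    rw [hN] at hle ⊢
    have h2 : N ≤ 5 := by
      simp only [maxDet] at hle
      push_cast at hle
      have : (N : ℝ) ≤ 5 := by linarith
      exact_mod_cast this
    interval_cases N <;> norm_num
  · obtain ⟨X, hX, hd⟩ := exists_isSignMatrix_abs_det_eq_maxDet (n := 6) (by norm_num) le_rfl
    have hmax : IsMaximal X := by
      refine (isMaximal_iff le_rfl hX fun h0 => ?_).mpr hd
      rw [h0] at hd
      norm_num [maxDet] at hd
    have hflip : ∀ d ∈ ({128, 96, 64} : Set ℝ),
        ∃ X : Matrix (Fin 6) (Fin 6) ℝ, IsSignMatrix X ∧ d = |X.det| := by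
      intro d hd
      rw [← hmax.setOf_abs_det_flipEntry] at hd
      obtain ⟨i, j, rfl⟩ := hd
      exact ⟨_, hX.flipEntry i j, rfl⟩
    rintro (rfl | rfl | rfl | rfl | rfl | rfl)
    · refine ⟨of fun _ _ => 1, fun _ _ => Or.inl rfl, ?_⟩
      rw [det_zero_of_row_eq (M := of fun _ _ => 1) (zero_ne_one' (Fin 6)) rfl, abs_zero]
    · obtain ⟨W, hW, hd⟩ := exists_isSignMatrix_abs_det_eq_thirtyTwo
      exact ⟨W, hW, by rw [hd]; norm_num⟩
    · exact hflip _ (by simp)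
    · exact hflip _ (by simp)
    · exact hflip _ (by simp)
    · exact ⟨X, hX, by rw [hd]; norm_num [maxDet]⟩

theorem IsMaximal.setOf_ratio {Y U : Matrix (Fin 6) (Fin 6) ℝ} (hY : Y.det ≠ 0)
    (hU : U.det ≠ 0) (hX : IsMaximal (U * Y)) :
    {r : ℝ | ∃ i j, r = |(neighbour Y U i j).det / U.det|} = {4 / 5, 3 / 5, 2 / 5} := by
  simp only [det_neighbour_div hY hU]
  exact hX.setOf_abs_one_sub_two_mul_weight

/-- At a maximal vertex the neighbours closest in value are those of ratio `4 / 5`, since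
`4 / 5`, the largest of the three ratios, is the one with the smallest `|log|`. -/
theorem IsMaximal.isNearest_iff {Y U : Matrix (Fin 6) (Fin 6) ℝ} (hY : Y.det ≠ 0)
    (hU : U.det ≠ 0) (hX : IsMaximal (U * Y)) (i j : Fin 6) :
    IsNearest (objective U) (neighbourValues Y U) i j ↔
      |(neighbour Y U i j).det / U.det| = 4 / 5 := by
  have hset := hX.setOf_ratio hY hU
  have hr : ∀ a b, 0 < |(neighbour Y U a b).det / U.det| ∧
      |(neighbour Y U a b).det / U.det| ≤ 4 / 5 := by
    intro a b
    have hm : |(neighbour Y U a b).det / U.det| ∈ ({4 / 5, 3 / 5, 2 / 5} : Set ℝ) :=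
      hset ▸ ⟨a, b, rfl⟩
    rcases hm with h | h | h <;> rw [h] <;> norm_num
  have hcmp : ∀ a b c d, (neighbourValues Y U a b - objective U).abs ≤
      (neighbourValues Y U c d - objective U).abs ↔
      |(neighbour Y U c d).det / U.det| ≤ |(neighbour Y U a b).det / U.det| := by
    intro a b c d
    have hne : ∀ a b, (neighbour Y U a b).det ≠ 0 := by
      intro a b h0
      have := (hr a b).1
      rw [h0] at this
      simp at this
    have hlog : ∀ a b, abs (Real.log |(neighbour Y U a b).det / U.det|) =
        -Real.log |(neighbour Y U a b).det / U.det| := fun a b =>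
      abs_of_nonpos (Real.log_nonpos (hr a b).1.le ((hr a b).2.trans (by norm_num)))
    unfold neighbourValues
    rw [objective_sub_objective_abs hU (hne a b), objective_sub_objective_abs hU (hne c d),
      ENNReal.ofReal_le_ofReal_iff (abs_nonneg _), hlog, hlog, neg_le_neg_iff,
      Real.log_le_log_iff (hr c d).1 (hr a b).1]
  unfold IsNearest
  simp only [hcmp]
  constructor
  · intro h
    obtain ⟨a, b, hab⟩ : (4 / 5 : ℝ) ∈
        {r : ℝ | ∃ i j, r = |(neighbour Y U i j).det / U.det|} := by rw [hset]; simp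
    exact le_antisymm (hr i j).2 (hab.trans_le (h a b))
  · intro h a b
    rw [h]
    exact (hr a b).2

/-! ### The stopping test -/

theorem stoppingTest_iff (hn : n ≤ 6) {Y U : Matrix (Fin n) (Fin n) ℝ} (hY : Y.det ≠ 0)
    (hv : IsVertex Y U) (hU : U.det ≠ 0) :
    StoppingTest (objective U) (neighbourValues Y U) ↔ |(U * Y).det| = maxDet n := by
  have hX : (U * Y).det ≠ 0 := by rw [det_mul]; exact mul_ne_zero hU hY
  unfold StoppingTest
  split_ifs with h1 h2
  · simp only [true_iff]
    exact IsSignMatrix.abs_det_eq_maxDet_of_le_three (by omega) hv hX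
  · refine ⟨abs_det_eq_maxDet_of_neighbour_lt h2 hY hv hU, fun h i j => ?_⟩
    have hn0 : n ≠ 0 := by
      rintro rfl
      exact i.elim0
    exact (objective_neighbour_lt_iff hY hU i j).mpr
      (((isMaximal_iff hn hv hX).mpr h).weight_pos_and_lt_one (by omega) hX i j)
  · obtain rfl : n = 6 := by omega
    constructor
    · rintro ⟨i, j, -, h⟩
      exact abs_det_eq_maxDet_of_ratio hY hv hU
        ((objective_eq_add_log_iff hU (by norm_num)).mp h)
    · intro h
      have hmax := (isMaximal_iff hn hv hX).mpr h
      obtain ⟨i, j, hij⟩ : (4 / 5 : ℝ) ∈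
          {r : ℝ | ∃ i j, r = |(neighbour Y U i j).det / U.det|} := by
        rw [hmax.setOf_ratio hY hU]; simp
      exact ⟨i, j, (hmax.isNearest_iff hY hU i j).mpr hij.symm,
        (objective_eq_add_log_iff hU (by norm_num)).mpr hij.symm⟩

theorem isGlobalOptimum_of_stoppingTest (hn : n ≤ 6) {Y : Matrix (Fin n) (Fin k) ℝ}
    {U : Matrix (Fin n) (Fin n) ℝ} {g : Fin n → Fin k} (hY : (Y.submatrix id g).det ≠ 0)
    (hv : IsVertex Y U) (hU : U.det ≠ 0)
    (h : StoppingTest (objective U) (neighbourValues (Y.submatrix id g) U)) :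
    IsGlobalOptimum Y U :=
  isGlobalOptimum_of_abs_det_eq_maxDet hn hY hv hU
    ((stoppingTest_iff hn hY (hv.submatrix id g) hU).mp h)

/-- The optimum `U` is at least as good as the feasible matrix `A⁻¹`, which maps the distinguished
columns of `A * X` to a matrix of the largest determinant. -/
theorem IsGlobalOptimum.exists_stoppingTest (hn : n ≤ 6) {A U : Matrix (Fin n) (Fin n) ℝ}
    {X : Matrix (Fin n) (Fin k) ℝ} (hA : A.det ≠ 0) (hX : IsSignMatrix X) (hmsp : HasMSP X)
    (hv : IsVertex (A * X) U) (hU : U.det ≠ 0) (h : IsGlobalOptimum (A * X) U) :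
    ∃ g : Fin n → Fin k, ((A * X).submatrix id g).det ≠ 0 ∧
      StoppingTest (objective U) (neighbourValues ((A * X).submatrix id g) U) := by
  obtain ⟨g, hg⟩ := hmsp
  have hpos : 0 < |(X.submatrix id g).det| := by
    refine lt_of_lt_of_le ?_ (hg 1 fun i j => ?_)
    · simp
    · rw [one_apply]; split_ifs <;> norm_num
  have hsub : (A * X).submatrix id g = A * X.submatrix id g := rfl
  have hY : ((A * X).submatrix id g).det ≠ 0 := by
    rw [hsub, det_mul]
    exact mul_ne_zero hA (abs_pos.mp hpos)
  have hAX : A⁻¹ * (A * X) = X := by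
    rw [← Matrix.mul_assoc, nonsing_inv_mul _ (isUnit_iff_ne_zero.mpr hA), Matrix.one_mul]
  have h1 := (objective_le_iff hU).mp (h.2 A⁻¹ (isFeasible_iff.mpr (by
    rw [hAX]; exact hX.mem_Icc)))
  rw [det_nonsing_inv, Ring.inverse_eq_inv', abs_inv, inv_le_iff_one_le_mul₀ (abs_pos.mpr hA)] at h1
  have hv' : IsVertex ((A * X).submatrix id g) U := hv.submatrix id g
  have hUY : (U * (A * X).submatrix id g).det ≠ 0 := by
    rw [det_mul]; exact mul_ne_zero hU hY
  refine ⟨g, hY, (stoppingTest_iff hn hY hv' hU).mpr ((isMaximal_iff hn hv' hUY).mp ⟨hv', ?_⟩)⟩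
  intro W hW
  refine (hg W hW.mem_Icc).trans ?_
  rw [hsub, det_mul, det_mul, abs_mul, abs_mul, ← mul_assoc]
  exact le_mul_of_one_le_left hpos.le h1

end ParallelepipedFit

end

open ParallelepipedFit in
theorem mainTheorem1 (n : ℕ) (hn : n ≤ 6) :
    -- the case `k = n`: the test on the `n²` neighbours decides global optimality
    (∀ Y U : Matrix (Fin n) (Fin n) ℝ, Y.det ≠ 0 → IsVertex Y U → U.det ≠ 0 →
      (IsGlobalOptimum Y U ↔ StoppingTest (objective U) (neighbourValues Y U))) ∧
    -- any number of samples: the test on `n` independent columns is sufficient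
    (∀ (k : ℕ) (Y : Matrix (Fin n) (Fin k) ℝ) (g : Fin n → Fin k) (U : Matrix (Fin n) (Fin n) ℝ),
      (Y.submatrix id g).det ≠ 0 → IsVertex Y U → U.det ≠ 0 →
      StoppingTest (objective U) (neighbourValues (Y.submatrix id g) U) →
      IsGlobalOptimum Y U) ∧
    -- any number of samples: under the maximal subset property it is also necessary
    (∀ (k : ℕ) (A : Matrix (Fin n) (Fin n) ℝ) (X : Matrix (Fin n) (Fin k) ℝ)
      (U : Matrix (Fin n) (Fin n) ℝ),
      A.det ≠ 0 → IsSignMatrix X → HasMSP X → IsVertex (A * X) U → U.det ≠ 0 →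
      (IsGlobalOptimum (A * X) U ↔
        ∃ g : Fin n → Fin k, ((A * X).submatrix id g).det ≠ 0 ∧
          StoppingTest (objective U) (neighbourValues ((A * X).submatrix id g) U))) ∧
    -- `n ≤ 5`: no vertex is a non-global local optimum; if all neighbours decrease the
    -- objective, then the vertex is a global optimum
    (n ≤ 5 → ∀ Y U : Matrix (Fin n) (Fin n) ℝ, Y.det ≠ 0 → IsVertex Y U → U.det ≠ 0 →
      (IsLocalOptimum Y U → IsGlobalOptimum Y U) ∧
      ((∀ i j, objective (neighbour Y U i j) < objective U) → IsGlobalOptimum Y U)) ∧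
    -- `n = 6`: the spectrum, the neighbours of a maximal matrix, and the ratio `4/5`
    (n = 6 →
      {d : ℝ | ∃ X : Matrix (Fin n) (Fin n) ℝ, IsSignMatrix X ∧ d = |X.det|} =
        {0, 32, 64, 96, 128, 160} ∧
      (∀ X : Matrix (Fin n) (Fin n) ℝ, IsMaximal X →
        {d : ℝ | ∃ i j, d = |(flipEntry X i j).det|} = {128, 96, 64}) ∧
      (∀ Y U : Matrix (Fin n) (Fin n) ℝ, Y.det ≠ 0 → IsVertex Y U → U.det ≠ 0 →
        (IsGlobalOptimum Y U →
          {r : ℝ | ∃ i j, r = |(neighbour Y U i j).det / U.det|} = {4 / 5, 3 / 5, 2 / 5}) ∧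
        (IsGlobalOptimum Y U ↔ ∃ i j, |(neighbour Y U i j).det / U.det| = 4 / 5) ∧
        (∀ i j, IsNearest (objective U) (neighbourValues Y U) i j →
          (IsGlobalOptimum Y U ↔ |(neighbour Y U i j).det / U.det| = 4 / 5)))) := by
  refine ⟨fun Y U hY hv hU => ?_, fun k Y g U hY hv hU h => ?_, fun k A X U hA hX hm hv hU => ?_,
    fun h5 Y U hY hv hU => ⟨fun h => ?_, fun h => ?_⟩, fun h6 => ?_⟩
  · rw [isGlobalOptimum_iff hn hY hv hU, stoppingTest_iff hn hY hv hU]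
  · exact isGlobalOptimum_of_stoppingTest hn hY hv hU h
  · exact ⟨fun h => h.exists_stoppingTest hn hA hX hm hv hU,
      fun ⟨g, hg, h⟩ => isGlobalOptimum_of_stoppingTest hn hg hv hU h⟩
  · exact (isGlobalOptimum_iff hn hY hv hU).mpr (h.abs_det_eq_maxDet h5 hY hv hU)
  · exact (isGlobalOptimum_iff hn hY hv hU).mpr
      (abs_det_eq_maxDet_of_neighbour_lt h5 hY hv hU h)
  · subst h6
    refine ⟨setOf_abs_det_isSignMatrix_six, fun X hX => hX.setOf_abs_det_flipEntry,
      fun Y U hY hv hU => ?_⟩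
    have hX : (U * Y).det ≠ 0 := by rw [Matrix.det_mul]; exact mul_ne_zero hU hY
    have hglob : IsGlobalOptimum Y U ↔ IsMaximal (U * Y) := by
      rw [isGlobalOptimum_iff hn hY hv hU, isMaximal_iff hn hv hX]
    have hof : ∀ i j, |(neighbour Y U i j).det / U.det| = 4 / 5 → IsGlobalOptimum Y U :=
      fun i j h => (isGlobalOptimum_iff hn hY hv hU).mpr (abs_det_eq_maxDet_of_ratio hY hv hU h)
    refine ⟨fun h => (hglob.mp h).setOf_ratio hY hU, ⟨fun h => ?_, fun ⟨i, j, h⟩ => hof i j h⟩,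
      fun i j hij => ⟨fun h => ((hglob.mp h).isNearest_iff hY hU i j).mp hij, hof i j⟩⟩
    have hmem : (4 / 5 : ℝ) ∈ {r : ℝ | ∃ i j, r = |(neighbour Y U i j).det / U.det|} := by
      rw [(hglob.mp h).setOf_ratio hY hU]; simp
    exact hmem.imp fun i hi => hi.imp fun j hj => hj.symm
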